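/- Let $M$ be a smooth (Hausdorff) $n$-dimensional manifold, $f_0,f_1,\dots,f_m$ smooth vector fields on $M$, $T>0$, and consider the problem of minimizing $\int_0^T|u(t)|\,dt$ for $\dot q=f_0(q)+\sum_{i=1}^m u_i f_i(q)$ with measurable controls $u:[0,T]\to\{u\in\mathbb R^m:|u|\le 1\}$ ($|\cdot|$ Euclidean) and fixed end points. On $T^*M$, with canonical symplectic form $\sigma=dp\wedge dq$, let $\vec h$ be defined by $dh=\sigma(\cdot,\vec h)$ and $\{a,b\}=\vec a(b)=\sigma(\vec a,\vec b)$. Put $h_i(\lambda)=\langle\lambda,f_i\rangle$, $h_I=(h_1,\dots,h_m)$, $h_c=\tfrac12|h_I|^2$, $h_{c0c}=\{h_c,\{h_0,h_c\}\}$ and $H(\lambda,u)=h_0(\lambda)+\langle u,h_I(\lambda)\rangle-|u|$. Let $\lambda:[0,T]\to T^*M$ be a singular extremal with control $u$: $\lambda$ is absolutely continuous, for almost every $t$ one has $\dot\lambda(t)=\vec H(\cdot,u(t))(\lambda(t))$ and $H(\lambda(t),u(t))=\max_{|v|\le1}H(\lambda(t),v)$, and $|h_I(\lambda(t))|=1$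 for all $t\in[0,T]$. (Then $u(t)=r(t)h_I(\lambda(t))$ for almost every $t$, with $r=|u|$.) Write $\lambda_0=\lambda(0)$, $\sigma=\sigma_{\lambda_0}$, $h_I(t)=h_I(\lambda(t))$, and let $\Phi_t$, $t\in[0,T]$, be the flow, from time $0$ and near $\lambda_0$, of the time-dependent Hamiltonian field $\vec H(\cdot,u(t))$, where the control $u(t)$ is that of the extremal. Define $$Z_tv=\sum_{i=1}^m v_i\,\big[(\Phi_t^{-1})_*\vec h_i\big](\lambda_0)\in T_{\lambda_0}(T^*M)\quad(v\in\mathbb R^m),\qquad Z_I(t)=Z_th_I(t).$$ Then $\Phi_t$ has an invertible differential at $\lambda_0$ for every $t\in[0,T]$, and there is a set $S\subseteq[0,T]$ of full measure, containing every $t\in[0,T]$ at which $u$ is continuous, such that $Z_I$ is differentiable at each $t\in S$ (one-sidedly at end points) and the following holds for every $t\in S$ with $r(t)>0$. Let $$l_t=\begin{pmatrix}\frac{1}{r(t)}\mathrm{Id}_m&\sigma(Z_t\,\cdot,Z_I(t))\\ \sigma(Z_t\,\cdot,Z_I(t))^{T}&\sigma(Z_I(t),\dot Z_I(t))\end{pmatrix}\in\mathbb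 R^{(m+1)\times(m+1)},$$ and let $l_t(w,\phi)$ also denote its quadratic form on $\mathbb R^m\oplus\mathbb R$. Then $$l_t\ge0\iff h_{c0c}(\lambda(t))\ge0,\qquad l_t>0\iff h_{c0c}(\lambda(t))>0,$$ where $l_t\ge0$ ($l_t>0$) means nonnegative (positive) definiteness; both equivalences hold when $l_t$ is considered as a form on $h_I(t)^\perp\oplus\mathbb R$, and also when it is considered as a full $(m+1)\times(m+1)$ matrix. -/

import Mathlib

open Bundle Set Filter Topology MeasureTheory
open scoped Manifold ContDiff Matrix

noncomputable section

/-- The controls: `ℝᵐ` with its Euclidean norm. -/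
abbrev Control (m : ℕ) := EuclideanSpace ℝ (Fin m)

/-- The model vector space `ℝⁿ × (ℝⁿ)*` of the cotangent bundle of an `n`-manifold. -/
abbrev PhaseModel (n : ℕ) :=
  EuclideanSpace ℝ (Fin n) × (EuclideanSpace ℝ (Fin n) →L[ℝ] ℝ)

/-- The model with corners (without boundary) of the cotangent bundle of an `n`-manifold. -/
abbrev cotModel (n : ℕ) :=
  (𝓡 n).prod 𝓘(ℝ, EuclideanSpace ℝ (Fin n) →L[ℝ] ℝ)

section Phase

variable (n : ℕ) (M : Type*) [TopologicalSpace M] [ChartedSpace (EuclideanSpace ℝ (Fin n)) M]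

/-- The cotangent bundle `T*M`, with the vector bundle and manifold structures that Mathlib puts
on the bundle of continuous linear maps from `TM` to the trivial line bundle. Its preferred chart
at `ℓ` consists of the canonical coordinates `(q, p)` induced by the preferred chart of `M` at
the base point of `ℓ`. -/
abbrev CotangentBundle :=
  TotalSpace (EuclideanSpace ℝ (Fin n) →L[ℝ] ℝ) (fun x : M => TangentSpace (𝓡 n) x →L[ℝ] ℝ)

variable {n M} [IsManifold (𝓡 n) ∞ M]

/-- The canonical symplectic form `σ = dp ∧ dq` (the differential of the Liouville form `p dq`)
at `ℓ ∈ T*M`. In Mathlib a vector tangent to `T*M` at `ℓ` is the pair `(X_q, X_p)` of its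
components in the preferred chart at `ℓ`, which is a canonical chart; so
`σ(X, Y) = ⟨X_p, Y_q⟩ - ⟨Y_p, X_q⟩`. -/
def symplecticForm (ℓ : CotangentBundle n M) (X Y : TangentSpace (cotModel n) ℓ) : ℝ :=
  (X : PhaseModel n).2 (Y : PhaseModel n).1 - (Y : PhaseModel n).2 (X : PhaseModel n).1

/-- The differential of a function on `T*M`, as a functional on `ℝⁿ × (ℝⁿ)*`. -/
def phaseDiff (h : CotangentBundle n M → ℝ) (ℓ : CotangentBundle n M) : PhaseModel n →L[ℝ] ℝ :=
  mfderiv (cotModel n) 𝓘(ℝ, ℝ) h ℓ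

/-- The Hamiltonian vector field of `h`: `q̇ = ∂h/∂p`, `ṗ = -∂h/∂q`. It is the solution of
`dh = σ(·, hamVF h)`, see the lemma below. -/
def hamVF (h : CotangentBundle n M → ℝ) (ℓ : CotangentBundle n M) : TangentSpace (cotModel n) ℓ :=
  ((WithLp.toLp 2 fun i => phaseDiff h ℓ (0, EuclideanSpace.proj i),
    -(phaseDiff h ℓ).comp (ContinuousLinearMap.inl ℝ _ _)) : PhaseModel n)

theorem mfderiv_eq_symplecticForm_hamVF (h : CotangentBundle n M → ℝ) (ℓ : CotangentBundle n M)
    (X : TangentSpace (cotModel n) ℓ) :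
    mfderiv (cotModel n) 𝓘(ℝ, ℝ) h ℓ X = symplecticForm ℓ X (hamVF h ℓ) := by
  change phaseDiff h ℓ (X : PhaseModel n) = _
  have key : ∀ Y : PhaseModel n, phaseDiff h ℓ Y =
      Y.2 (WithLp.toLp 2 fun i => phaseDiff h ℓ (0, EuclideanSpace.proj i)) +
        phaseDiff h ℓ (Y.1, 0) := by
    rintro ⟨q, p⟩
    have hv : ∀ v : EuclideanSpace ℝ (Fin n),
        v = ∑ i, v i • EuclideanSpace.single i (1 : ℝ) := by
      intro v
      ext j
      simp [Finset.sum_apply, Pi.single_apply]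
    have hp : p = ∑ i, p (EuclideanSpace.single i 1) •
        (EuclideanSpace.proj i : EuclideanSpace ℝ (Fin n) →L[ℝ] ℝ) := by
      ext v
      conv_lhs => rw [hv v]
      simp [map_sum, mul_comm]
    have h1 : ((q, p) : PhaseModel n) = (q, 0) + ContinuousLinearMap.inr ℝ _ _ p := by simp
    have h2 : phaseDiff h ℓ (ContinuousLinearMap.inr ℝ _ _ p) =
        p (WithLp.toLp 2 fun i => phaseDiff h ℓ (0, EuclideanSpace.proj i)) := by
      conv_lhs => rw [hp]
      conv_rhs => rw [hv (WithLp.toLp 2 _)]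
      rw [map_sum, map_sum, map_sum]
      refine Finset.sum_congr rfl fun i _ => ?_
      rw [map_smul, map_smul, map_smul, smul_eq_mul, smul_eq_mul, mul_comm]
      simp
    rw [h1, map_add, h2]
    simp [add_comm]
  refine (key X).trans ?_
  simp [symplecticForm, hamVF]

/-- The Poisson bracket `{a, b} = db(hamVF a) = σ(hamVF a, hamVF b)`. -/
def poisson (a b : CotangentBundle n M → ℝ) (ℓ : CotangentBundle n M) : ℝ :=
  mfderiv (cotModel n) 𝓘(ℝ, ℝ) b ℓ (hamVF a ℓ)

/-- The function `ℓ ↦ ⟨ℓ, X⟩` on `T*M` defined by a vector field `X` on `M`. -/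
def linHam (X : ∀ x : M, TangentSpace (𝓡 n) x) (ℓ : CotangentBundle n M) : ℝ :=
  ℓ.2 (X ℓ.1)

/-- `X` is a smooth vector field on `M`. -/
def IsSmoothVF (X : ∀ x : M, TangentSpace (𝓡 n) x) : Prop :=
  ContMDiff (𝓡 n) (𝓡 n).tangent ∞ fun x => (⟨x, X x⟩ : TangentBundle (𝓡 n) M)

/-- `γ` is a solution on `[0, T]` of the time-dependent equation `γ̇ = F t γ` on `T*M` with
measurable time dependence: it is continuous, absolutely continuous in every chart, and satisfies
the equation at almost every time. -/
structure IsSolution (F : ℝ → ∀ ℓ : CotangentBundle n M, TangentSpace (cotModel n) ℓ) (T : ℝ)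
    (γ : ℝ → CotangentBundle n M) : Prop where
  continuousOn : ContinuousOn γ (Icc 0 T)
  absolutelyContinuous : ∀ (ℓ : CotangentBundle n M) (a b : ℝ), 0 ≤ a → a ≤ b → b ≤ T →
    MapsTo γ (Icc a b) (extChartAt (cotModel n) ℓ).source →
    AbsolutelyContinuousOnInterval (fun t => extChartAt (cotModel n) ℓ (γ t)) a b
  ae_hasDeriv : ∀ᵐ t, t ∈ Ioo 0 T →
    HasMFDerivAt 𝓘(ℝ, ℝ) (cotModel n) γ t (ContinuousLinearMap.toSpanSingleton ℝ (F t (γ t)))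

variable {m : ℕ} (f₀ : ∀ x : M, TangentSpace (𝓡 n) x)
  (f : Fin m → ∀ x : M, TangentSpace (𝓡 n) x)

/-- The vector `h_I(ℓ) = (h₁(ℓ), …, hₘ(ℓ))`, where `hᵢ(ℓ) = ⟨ℓ, fᵢ⟩`. -/
def hI (ℓ : CotangentBundle n M) : Control m :=
  WithLp.toLp 2 fun i => linHam (f i) ℓ

/-- `h_c = |h_I|² / 2`. -/
def hC (ℓ : CotangentBundle n M) : ℝ := ‖hI f ℓ‖ ^ 2 / 2

/-- `h_{c0c} = {h_c, {h₀, h_c}}`. -/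
def hC0C (ℓ : CotangentBundle n M) : ℝ :=
  poisson (hC f) (poisson (linHam f₀) (hC f)) ℓ

/-- The normal Pontryagin Hamiltonian `h₀ + ⟨u, h_I⟩ - |u|` of the `L¹` problem. -/
def pmpHam (u : Control m) (ℓ : CotangentBundle n M) : ℝ :=
  linHam f₀ ℓ + ∑ i, u i * hI f ℓ i - ‖u‖

/-- `lam` is a singular (normal) extremal on `[0, T]`, with control `u`, of the problem of
minimizing `∫ |u|` for `q̇ = f₀(q) + ∑ uᵢ fᵢ(q)`, `|u| ≤ 1`: it satisfies the Pontryagin maximum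
principle, and `|h_I| = 1` along it. -/
structure IsSingularExtremal (T : ℝ) (u : ℝ → Control m) (lam : ℝ → CotangentBundle n M) :
    Prop where
  aemeasurable : AEMeasurable u (volume.restrict (Icc 0 T))
  norm_le_one : ∀ t ∈ Icc 0 T, ‖u t‖ ≤ 1
  isSolution : IsSolution (fun t => hamVF (pmpHam f₀ f (u t))) T lam
  maximum : ∀ᵐ t, t ∈ Icc 0 T →
    ∀ v : Control m, ‖v‖ ≤ 1 → pmpHam f₀ f v (lam t) ≤ pmpHam f₀ f (u t) (lam t)
  singular : ∀ t ∈ Icc 0 T, ‖hI f (lam t)‖ = 1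

/-- `Φ` is, near `ℓ₀` and for times in `[0, T]`, the flow starting at time `0` of the
time-dependent Hamiltonian field of `pmpHam (u t)`. -/
def IsFlowNear (T : ℝ) (u : ℝ → Control m) (ℓ₀ : CotangentBundle n M)
    (Φ : ℝ → CotangentBundle n M → CotangentBundle n M) : Prop :=
  ∀ᶠ ℓ in 𝓝 ℓ₀, Φ 0 ℓ = ℓ ∧
    IsSolution (fun t => hamVF (pmpHam f₀ f (u t))) T fun t => Φ t ℓ

/-- `Z_t v = ∑ vᵢ ((Φ_t⁻¹)_* h⃗ᵢ)(ℓ₀)`: the differential of `Φ_t⁻¹` at `Φ_t(ℓ₀)` is the inverse of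
the differential of `Φ_t` at `ℓ₀`. -/
def zMap (Φ : ℝ → CotangentBundle n M → CotangentBundle n M) (ℓ₀ : CotangentBundle n M) (t : ℝ)
    (v : Control m) : TangentSpace (cotModel n) ℓ₀ :=
  (mfderiv (cotModel n) (cotModel n) (Φ t) ℓ₀).inverse
    (∑ i, v i • hamVF (linHam (f i)) (Φ t ℓ₀))

/-- `Z_I(t) = Z_t h_I(lam t)`, a curve in the fixed vector space `T_{lam 0}(T*M)`. -/
def zI (Φ : ℝ → CotangentBundle n M → CotangentBundle n M) (lam : ℝ → CotangentBundle n M)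
    (t : ℝ) : PhaseModel n :=
  zMap f Φ (lam 0) t (hI f (lam t))

/-- The derivative of `Z_I` at a time of `[0, T]` (one-sided at the end points). -/
def zIDot (T : ℝ) (Φ : ℝ → CotangentBundle n M → CotangentBundle n M)
    (lam : ℝ → CotangentBundle n M) (t : ℝ) : PhaseModel n :=
  derivWithin (zI f Φ lam) (Icc 0 T) t

/-- The `(m+1) × (m+1)` matrix of the Legendre form `l_t`, where `r = |u(t)|`. -/
def legendreMatrix (T : ℝ) (u : ℝ → Control m) (lam : ℝ → CotangentBundle n M)
    (Φ : ℝ → CotangentBundle n M → CotangentBundle n M) (t : ℝ) :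
    Matrix (Fin m ⊕ Unit) (Fin m ⊕ Unit) ℝ :=
  let a : Fin m → ℝ := fun i =>
    symplecticForm (lam 0) (zMap f Φ (lam 0) t (EuclideanSpace.single i 1)) (zI f Φ lam t)
  Matrix.fromBlocks ((1 / ‖u t‖) • 1) (Matrix.of fun i _ => a i) (Matrix.of fun _ j => a j)
    (Matrix.of fun _ _ => symplecticForm (lam 0) (zI f Φ lam t) (zIDot f T Φ lam t))

/-- The value `l_t(w, φ)` of the Legendre form. -/
def legendreForm (T : ℝ) (u : ℝ → Control m) (lam : ℝ → CotangentBundle n M)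
    (Φ : ℝ → CotangentBundle n M → CotangentBundle n M) (t : ℝ) (w : Control m) (φ : ℝ) : ℝ :=
  let x : Fin m ⊕ Unit → ℝ := Sum.elim (fun i => w i) (fun _ => φ)
  x ⬝ᵥ (legendreMatrix f T u lam Φ t *ᵥ x)

end Phase

end

/-! The canonical charts of `T*M` are symplectic (`stdSymp_mfderiv_extChartAt`), so all computations
can be made in `V × V*`. Let `P` be the differential of `Φ_t` at `λ₀` read in such a chart, and
`X_u` the field `h⃗₀ + Σ uᵢ h⃗ᵢ`. Then `Ṗ = DX_u P`, and `P` preserves `σ` because the differential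
of a Hamiltonian field is skew for `σ`. Since `h⃗_c = Σ hᵢ h⃗ᵢ`, one has `Z_I = P⁻¹ h⃗_c`, and the
quotient rule gives `Ż_I = P⁻¹ [X_u, h⃗_c]` with `[X, Y] = DY X - DX Y` (`hasDerivWithinAt_zI`).
Hence the off-diagonal entries of `l_t` are `aᵢ = {hᵢ, h_c}`, and the corner entry is `h_{c0c} + Σ
uᵢ {h_c, {hᵢ, h_c}}`.

Two consequences of `{h_c, h_c} = 0` finish the computation (`sum_mul_flatPoisson_halfSumSq`).
Written as `Σ hᵢ {hᵢ, h_c} = 0`, it says that `a` is orthogonal to `h_I`; differentiated along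
`h⃗_c`, it gives `Σ hᵢ {h_c, {hᵢ, h_c}} = |a|²`. With `u = r h_I` the corner entry becomes `h_{c0c}
+ r |a|²`, so that `l_t(w, φ) = |w + r φ a|² / r + φ² h_{c0c}`. The sign is decided at `w = -r a`,
`φ = 1`; this `w` lies in `h_I^⊥`, which is why the restricted form and the full matrix obey the
same criterion.

The analytic work comes from `u` being merely measurable and `Φ` being given only as a family of
Carathéodory solutions. On short time intervals, contraction estimates in one chart show that the
differential of the flow is propagated by the resolvent of the linearized equation
(`IsFlowRegular.propagate`), and finitely many such intervals cover `[0, T]`. The set `S` consists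
of the times at which `∫ u` has derivative `u(t)` and `u = |u| h_I`. Differentiability of `∫ u`
suffices because all integrands are combinations of the `uᵢ` and `1` with continuous coefficients
(`hasDerivWithinAt_primitive_smul`). -/

noncomputable section

set_option synthInstance.maxHeartbeats 400000
set_option linter.unusedSectionVars false

/-! ### Symplectic linear algebra on `V × V*` -/

section SymplecticVectorSpace

variable {V : Type*} [NormedAddCommGroup V] [NormedSpace ℝ V]

/-- The standard symplectic form on `V × V*`. -/
def stdSymp : (V × (V →L[ℝ] ℝ)) →L[ℝ] (V × (V →L[ℝ] ℝ)) →L[ℝ] ℝ :=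
  let B := ((ContinuousLinearMap.compL ℝ (V × (V →L[ℝ] ℝ)) V ℝ).flip
    (ContinuousLinearMap.fst ℝ V (V →L[ℝ] ℝ))) ∘L (ContinuousLinearMap.snd ℝ V (V →L[ℝ] ℝ))
  B - B.flip

@[simp]
theorem stdSymp_apply (X Y : V × (V →L[ℝ] ℝ)) : stdSymp X Y = X.2 Y.1 - Y.2 X.1 :=
  rfl

theorem stdSymp_antisymm (X Y : V × (V →L[ℝ] ℝ)) : stdSymp X Y = -stdSymp Y X := by simp

theorem stdSymp_nondegenerate {X : V × (V →L[ℝ] ℝ)} (h : ∀ Y, stdSymp Y X = 0) : X = 0 := by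
  have h2 : X.2 = 0 := by
    ext v
    simpa using h (v, 0)
  have h1 : X.1 = 0 := by
    by_contra hne
    obtain ⟨g, -, hg⟩ := exists_dual_vector ℝ X.1 (norm_ne_zero_iff.mpr hne)
    have := h (0, g)
    simp only [stdSymp_apply, map_zero, sub_zero] at this
    rw [this] at hg
    exact hne (norm_eq_zero.mp (by simpa using hg.symm))
  exact Prod.ext h1 h2

/-- The cotangent lift of a change of coordinates is symplectic. -/
theorem stdSymp_map_cotangentLift {φ : V → V} {ψ : V × (V →L[ℝ] ℝ) → V × (V →L[ℝ] ℝ)}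
    {D : (V × (V →L[ℝ] ℝ)) →L[ℝ] (V × (V →L[ℝ] ℝ))} {y : V × (V →L[ℝ] ℝ)}
    (hψ : HasFDerivAt ψ D y) (hφ : ContDiffAt ℝ 2 φ y.1)
    (h : ∀ᶠ z in 𝓝 y, (ψ z).1 = φ z.1 ∧ (ψ z).2 ∘L fderiv ℝ φ z.1 = z.2)
    (X Y : V × (V →L[ℝ] ℝ)) : stdSymp (D X) (D Y) = stdSymp X Y := by
  have hd : DifferentiableAt ℝ φ y.1 := hφ.differentiableAt (by norm_num)
  have hd2 : DifferentiableAt ℝ (fderiv ℝ φ) y.1 :=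
    (hφ.fderiv_right (m := 1) (by norm_num)).differentiableAt (by norm_num)
  have hsymm : IsSymmSndFDerivAt ℝ φ y.1 := hφ.isSymmSndFDerivAt (by simp)
  have h1 : (ContinuousLinearMap.fst ℝ V (V →L[ℝ] ℝ)) ∘L D
      = fderiv ℝ φ y.1 ∘L ContinuousLinearMap.fst ℝ V (V →L[ℝ] ℝ) := by
    have a1 : HasFDerivAt (fun z => (ψ z).1) ((ContinuousLinearMap.fst ℝ V (V →L[ℝ] ℝ)) ∘L D) y :=
      (ContinuousLinearMap.fst ℝ V (V →L[ℝ] ℝ)).hasFDerivAt.comp y hψ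
    have a2 : HasFDerivAt (fun z : V × (V →L[ℝ] ℝ) => φ z.1)
        (fderiv ℝ φ y.1 ∘L ContinuousLinearMap.fst ℝ V (V →L[ℝ] ℝ)) y :=
      hd.hasFDerivAt.comp y hasFDerivAt_fst
    exact a1.unique (a2.congr_of_eventuallyEq (h.mono fun z hz => hz.1))
  -- Derivative of the relation `ψ₂ ∘ Dφ = p`. Its Hessian term is symmetric in the two base
  -- directions, so it drops out when the identities for `(X, Y)` and `(Y, X)` are subtracted.
  have h2 : ∀ Z W : V × (V →L[ℝ] ℝ), (D Z).2 (fderiv ℝ φ y.1 W.1)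
      + (ψ y).2 (fderiv ℝ (fderiv ℝ φ) y.1 Z.1 W.1) = Z.2 W.1 := by
    intro Z W
    have a1 : HasFDerivAt (fun z => (ψ z).2 ∘L fderiv ℝ φ z.1) _ y :=
      ((ContinuousLinearMap.snd ℝ V (V →L[ℝ] ℝ)).hasFDerivAt.comp y hψ).clm_comp
        (hd2.hasFDerivAt.comp y hasFDerivAt_fst)
    have a2 := a1.unique (hasFDerivAt_snd.congr_of_eventuallyEq (h.mono fun z hz => hz.2))
    have a3 := congrArg (fun L => L Z W.1) a2
    simp only [Function.comp_def] at a3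
    simpa [add_comm] using a3
  have h1' : ∀ Z, (D Z).1 = fderiv ℝ φ y.1 Z.1 := fun Z => by simpa using congrArg (fun L => L Z) h1
  have e1 := h2 X Y
  have e2 := h2 Y X
  rw [hsymm.eq X.1 Y.1] at e1
  rw [stdSymp_apply, stdSymp_apply, h1', h1']
  linarith

variable [FiniteDimensional ℝ V]

theorem stdSymp_flip_surjective :
    Function.Surjective (stdSymp (V := V)).flip := by
  have hinj : Function.Injective (stdSymp (V := V)).flip.toLinearMap := by
    refine (injective_iff_map_eq_zero _).mpr fun X hX => stdSymp_nondegenerate fun Y => ?_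
    exact congrArg (fun L : (V × (V →L[ℝ] ℝ)) →L[ℝ] ℝ => L Y) hX
  have hdim : Module.finrank ℝ (V × (V →L[ℝ] ℝ)) =
      Module.finrank ℝ ((V × (V →L[ℝ] ℝ)) →L[ℝ] ℝ) := by
    rw [← (LinearMap.toContinuousLinearMap (𝕜 := ℝ) (E := V × (V →L[ℝ] ℝ)) (F' := ℝ)).finrank_eq]
    exact Subspace.dual_finrank_eq.symm
  exact (LinearMap.injective_iff_surjective_of_finrank_eq_finrank hdim).mp hinj

/-- The map `α ↦ Y` with `α = σ(·, Y)`. -/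
def symplecticSharp : ((V × (V →L[ℝ] ℝ)) →L[ℝ] ℝ) →L[ℝ] (V × (V →L[ℝ] ℝ)) :=
  LinearMap.toContinuousLinearMap
    (((stdSymp (V := V)).flip.toLinearMap.exists_rightInverse_of_surjective
      (LinearMap.range_eq_top.mpr stdSymp_flip_surjective)).choose)

theorem stdSymp_symplecticSharp (α : (V × (V →L[ℝ] ℝ)) →L[ℝ] ℝ) (X : V × (V →L[ℝ] ℝ)) :
    stdSymp X (symplecticSharp α) = α X := by
  have h := ((stdSymp (V := V)).flip.toLinearMap.exists_rightInverse_of_surjective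
      (LinearMap.range_eq_top.mpr stdSymp_flip_surjective)).choose_spec
  exact congrArg (fun L : (V × (V →L[ℝ] ℝ)) →L[ℝ] ℝ => L X) (LinearMap.congr_fun h α)

/-- The Hamiltonian field of a function on the phase space `V × V*`. -/
def flatHamVF (g : V × (V →L[ℝ] ℝ) → ℝ) (y : V × (V →L[ℝ] ℝ)) : V × (V →L[ℝ] ℝ) :=
  symplecticSharp (fderiv ℝ g y)

theorem stdSymp_flatHamVF (g : V × (V →L[ℝ] ℝ) → ℝ) (y X : V × (V →L[ℝ] ℝ)) :
    stdSymp X (flatHamVF g y) = fderiv ℝ g y X :=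
  stdSymp_symplecticSharp _ _

end SymplecticVectorSpace

theorem symplecticForm_eq_stdSymp {n : ℕ} {M : Type*} [TopologicalSpace M]
    [ChartedSpace (EuclideanSpace ℝ (Fin n)) M] [IsManifold (𝓡 n) ∞ M] (ℓ : CotangentBundle n M)
    (X Y : PhaseModel n) : symplecticForm ℓ X Y = stdSymp X Y :=
  rfl

/-! ### Canonical charts of the cotangent bundle -/

section CotangentCharts

variable {n : ℕ} {M : Type*} [TopologicalSpace M] [ChartedSpace (EuclideanSpace ℝ (Fin n)) M]
  [IsManifold (𝓡 n) ∞ M]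

theorem mem_extChartAt_cot_source {c ℓ : CotangentBundle n M} :
    ℓ ∈ (extChartAt (cotModel n) c).source ↔ ℓ.1 ∈ (extChartAt (𝓡 n) c.1).source := by
  rw [FiberBundle.extChartAt]
  simp only [PartialEquiv.trans_source, hom_trivializationAt_source, mfld_simps]
  exact ⟨fun h => h.1.1, fun h => ⟨⟨h, by simp⟩, h⟩⟩

theorem mem_extChartAt_cot_target {c : CotangentBundle n M} {y : PhaseModel n} :
    y ∈ (extChartAt (cotModel n) c).target ↔ y.1 ∈ (extChartAt (𝓡 n) c.1).target := by
  rw [FiberBundle.extChartAt_target]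
  simp only [hom_trivializationAt_baseSet, Set.mem_prod, Set.mem_univ, and_true, Set.mem_inter_iff,
    Set.mem_preimage, TangentBundle.trivializationAt_baseSet]
  constructor
  · exact fun h => h.1
  · intro h
    refine ⟨h, ?_, ?_⟩
    · have := (extChartAt (𝓡 n) c.1).map_target h
      rwa [extChartAt_source] at this
    · simp

theorem extChartAt_cot_fst (c ℓ : CotangentBundle n M) :
    (extChartAt (cotModel n) c ℓ).1 = extChartAt (𝓡 n) c.1 ℓ.1 := by
  rw [FiberBundle.extChartAt]
  rfl

/-- The trivialization of the hom bundle precomposes a covector with the tangent coordinate change;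
on the target side, the trivial line bundle contributes the identity. -/
theorem extChartAt_cot_snd {c ℓ : CotangentBundle n M}
    (h : ℓ ∈ (extChartAt (cotModel n) c).source) (v : EuclideanSpace ℝ (Fin n)) :
    (extChartAt (cotModel n) c ℓ).2 v = ℓ.2 (tangentCoordChange (𝓡 n) c.1 ℓ.1 ℓ.1 v) := by
  have h' := mem_extChartAt_cot_source.mp h
  rw [extChartAt_source] at h'
  rw [FiberBundle.extChartAt]
  change (ContinuousLinearMap.inCoordinates (EuclideanSpace ℝ (Fin n))
    (TangentSpace (𝓡 n) : M → Type _) ℝ (Bundle.Trivial M ℝ) c.1 ℓ.1 c.1 ℓ.1 ℓ.2) v = _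
  simp only [ContinuousLinearMap.inCoordinates, ContinuousLinearMap.comp_apply]
  rw [TangentBundle.symmL_trivializationAt_eq_core h']
  change (Trivialization.continuousLinearMapAt ℝ (Bundle.Trivial.trivialization M ℝ) ℓ.1) _ = _
  rw [Bundle.Trivial.continuousLinearMapAt_trivialization]
  rfl

theorem contDiffAt_chart_transition {x y z : M} (hx : z ∈ (extChartAt (𝓡 n) x).source)
    (hy : z ∈ (extChartAt (𝓡 n) y).source) :
    ContDiffAt ℝ ∞ (extChartAt (𝓡 n) y ∘ (extChartAt (𝓡 n) x).symm) (extChartAt (𝓡 n) x z) := by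
  have h' : extChartAt (𝓡 n) x z ∈ ((extChartAt (𝓡 n) x).symm ≫ (extChartAt (𝓡 n) y)).source := by
    rw [PartialEquiv.trans_source'', PartialEquiv.symm_symm, PartialEquiv.symm_target]
    exact mem_image_of_mem _ ⟨hx, hy⟩
  have := contDiffWithinAt_ext_coord_change (n := ∞) (I := 𝓡 n) y x h'
  rwa [(𝓡 n).range_eq_univ, contDiffWithinAt_univ] at this

/-- Transitions between canonical charts are cotangent lifts of transitions of `M`; this is the
hypothesis that `stdSymp_map_cotangentLift` asks for. -/
theorem extChartAt_cot_snd_comp_transition {c d ℓ : CotangentBundle n M}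
    (hc : ℓ ∈ (extChartAt (cotModel n) c).source) (hd : ℓ ∈ (extChartAt (cotModel n) d).source) :
    (extChartAt (cotModel n) d ℓ).2 ∘L
      fderiv ℝ (extChartAt (𝓡 n) d.1 ∘ (extChartAt (𝓡 n) c.1).symm)
        (extChartAt (cotModel n) c ℓ).1 = (extChartAt (cotModel n) c ℓ).2 := by
  have hc' := mem_extChartAt_cot_source.mp hc
  have hd' := mem_extChartAt_cot_source.mp hd
  have h : fderiv ℝ (extChartAt (𝓡 n) d.1 ∘ (extChartAt (𝓡 n) c.1).symm)
      (extChartAt (cotModel n) c ℓ).1 = tangentCoordChange (𝓡 n) c.1 d.1 ℓ.1 := by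
    rw [tangentCoordChange_def, (𝓡 n).range_eq_univ, fderivWithin_univ, extChartAt_cot_fst]
  ext v
  rw [h, ContinuousLinearMap.comp_apply, extChartAt_cot_snd hd, extChartAt_cot_snd hc,
    tangentCoordChange_comp ⟨⟨hc', hd'⟩, mem_extChartAt_source ℓ.1⟩]

theorem hasMFDerivAt_extChartAt_cot {c ℓ : CotangentBundle n M}
    (h : ℓ ∈ (extChartAt (cotModel n) c).source) :
    HasMFDerivAt (cotModel n) 𝓘(ℝ, PhaseModel n) (extChartAt (cotModel n) c) ℓ
      (mfderiv (cotModel n) 𝓘(ℝ, PhaseModel n) (extChartAt (cotModel n) c) ℓ) :=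
  (mdifferentiableAt_extChartAt (by rwa [extChartAt_source] at h)).hasMFDerivAt

theorem hasMFDerivAt_cot_iff {E' : Type*} [NormedAddCommGroup E'] [NormedSpace ℝ E']
    {g : CotangentBundle n M → E'} {ℓ : CotangentBundle n M} {D : PhaseModel n →L[ℝ] E'} :
    HasMFDerivAt (cotModel n) 𝓘(ℝ, E') g ℓ D ↔ ContinuousAt g ℓ ∧
      HasFDerivAt (g ∘ (extChartAt (cotModel n) ℓ).symm) D (extChartAt (cotModel n) ℓ ℓ) := by
  have hw : writtenInExtChartAt (cotModel n) 𝓘(ℝ, E') ℓ g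
      = g ∘ (extChartAt (cotModel n) ℓ).symm := by
    ext z
    simp only [writtenInExtChartAt, extChartAt_model_space_eq_id, PartialEquiv.refl_coe,
      Function.comp_apply, id]
  change ContinuousAt g ℓ ∧ HasFDerivWithinAt
    (writtenInExtChartAt (cotModel n) 𝓘(ℝ, E') ℓ g) D (range (cotModel n))
      (extChartAt (cotModel n) ℓ ℓ) ↔ _
  rw [hw, (cotModel n).range_eq_univ]
  exact and_congr_right fun _ => hasFDerivWithinAt_univ

/-- The canonical charts of the cotangent bundle are symplectic. -/
theorem stdSymp_mfderiv_extChartAt {c ℓ : CotangentBundle n M}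
    (h : ℓ ∈ (extChartAt (cotModel n) c).source) (X Y : PhaseModel n) :
    stdSymp (mfderiv (cotModel n) 𝓘(ℝ, PhaseModel n) (extChartAt (cotModel n) c) ℓ X : PhaseModel n)
      (mfderiv (cotModel n) 𝓘(ℝ, PhaseModel n) (extChartAt (cotModel n) c) ℓ Y : PhaseModel n)
      = stdSymp X Y := by
  have h1 := (hasMFDerivAt_cot_iff.mp (hasMFDerivAt_extChartAt_cot h)).2
  have hℓ := mem_extChartAt_source (I := cotModel n) ℓ
  refine stdSymp_map_cotangentLift
    (φ := extChartAt (𝓡 n) c.1 ∘ (extChartAt (𝓡 n) ℓ.1).symm) h1 ?_ ?_ X Y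
  · rw [extChartAt_cot_fst]
    exact (contDiffAt_chart_transition (mem_extChartAt_source _)
      (mem_extChartAt_cot_source.mp h)).of_le (by norm_cast)
  · have e1 : ∀ᶠ z in 𝓝 (extChartAt (cotModel n) ℓ ℓ), z ∈ (extChartAt (cotModel n) ℓ).target :=
      extChartAt_target_mem_nhds ℓ
    have e2 : ∀ᶠ z in 𝓝 (extChartAt (cotModel n) ℓ ℓ),
        (extChartAt (cotModel n) ℓ).symm z ∈ (extChartAt (cotModel n) c).source := by
      have := continuousAt_extChartAt_symm (I := cotModel n) ℓ
      refine this.eventually_mem ?_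
      rw [extChartAt_to_inv]
      exact extChartAt_source_mem_nhds' h
    filter_upwards [e1, e2] with z hz1 hz2
    have hz3 := (extChartAt (cotModel n) ℓ).map_target hz1
    have hz4 := (extChartAt (cotModel n) ℓ).right_inv hz1
    have hk := extChartAt_cot_snd_comp_transition hz3 hz2
    rw [hz4] at hk
    rw [Function.comp_apply (f := extChartAt (cotModel n) c)]
    refine ⟨?_, hk⟩
    have hf := extChartAt_cot_fst ℓ ((extChartAt (cotModel n) ℓ).symm z)
    rw [hz4] at hf
    rw [extChartAt_cot_fst, hf, Function.comp_apply,
      (extChartAt (𝓡 n) ℓ.1).left_inv (mem_extChartAt_cot_source.mp hz3)]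

/-- Points over the same base point lie in one chart, and points over different base points are
separated by the projection. Hausdorffness is needed to know that compact pieces of a chart are
closed, so that solutions cannot escape from them by a limit. -/
instance [T2Space M] : T2Space (CotangentBundle n M) := by
  refine t2Space_iff_disjoint_nhds.mpr fun x y hxy => ?_
  by_cases hb : x.1 = y.1
  · have hx := mem_extChartAt_source (I := cotModel n) x
    have hy : y ∈ (extChartAt (cotModel n) x).source :=
      mem_extChartAt_cot_source.mpr (hb ▸ mem_extChartAt_source x.1)
    have hne : extChartAt (cotModel n) x x ≠ extChartAt (cotModel n) x y :=
      fun h => hxy ((extChartAt (cotModel n) x).injOn hx hy h)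
    exact (continuousAt_extChartAt' hx).disjoint (disjoint_nhds_nhds.mpr hne)
      (continuousAt_extChartAt' hy)
  · have hc : Continuous (fun z : CotangentBundle n M => z.1) := FiberBundle.continuous_proj _ _
    exact hc.continuousAt.disjoint (disjoint_nhds_nhds.mpr hb) hc.continuousAt

end CotangentCharts

/-! ### Hamiltonian functions and fields in canonical coordinates -/

section LocalRep

/-- The Poisson bracket on the phase space `V × V*`. -/
def flatPoisson {V : Type*} [NormedAddCommGroup V] [NormedSpace ℝ V] [FiniteDimensional ℝ V]
    (a b : V × (V →L[ℝ] ℝ) → ℝ) (y : V × (V →L[ℝ] ℝ)) : ℝ :=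
  fderiv ℝ b y (flatHamVF a y)

variable {n : ℕ} {M : Type*} [TopologicalSpace M] [ChartedSpace (EuclideanSpace ℝ (Fin n)) M]
  [IsManifold (𝓡 n) ∞ M]

/-- The function `h` on `T*M` in the canonical coordinates at `c`. -/
def localRep (c : CotangentBundle n M) (h : CotangentBundle n M → ℝ) : PhaseModel n → ℝ :=
  h ∘ (extChartAt (cotModel n) c).symm

/-- The differential at `ℓ` of the canonical coordinates at `c`. -/
def chartDiff (c ℓ : CotangentBundle n M) : PhaseModel n →L[ℝ] PhaseModel n :=
  mfderiv (cotModel n) 𝓘(ℝ, PhaseModel n) (extChartAt (cotModel n) c) ℓ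

variable {c ℓ : CotangentBundle n M}

theorem stdSymp_chartDiff (h : ℓ ∈ (extChartAt (cotModel n) c).source) (X Y : PhaseModel n) :
    stdSymp (chartDiff c ℓ X) (chartDiff c ℓ Y) = stdSymp X Y :=
  stdSymp_mfderiv_extChartAt h X Y

theorem chartDiff_isInvertible (h : ℓ ∈ (extChartAt (cotModel n) c).source) :
    (chartDiff c ℓ).IsInvertible :=
  isInvertible_mfderiv_extChartAt h

theorem localRep_extChartAt (h : ℓ ∈ (extChartAt (cotModel n) c).source)
    (g : CotangentBundle n M → ℝ) : localRep c g (extChartAt (cotModel n) c ℓ) = g ℓ := by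
  rw [localRep, Function.comp_apply, (extChartAt (cotModel n) c).left_inv h]

theorem hasMFDerivAt_of_localRep (h : ℓ ∈ (extChartAt (cotModel n) c).source)
    {g : CotangentBundle n M → ℝ}
    (hg : DifferentiableAt ℝ (localRep c g) (extChartAt (cotModel n) c ℓ)) :
    HasMFDerivAt (cotModel n) 𝓘(ℝ, ℝ) g ℓ
      (fderiv ℝ (localRep c g) (extChartAt (cotModel n) c ℓ) ∘L chartDiff c ℓ) := by
  have h1 := hg.hasFDerivAt.hasMFDerivAt.comp ℓ (hasMFDerivAt_extChartAt_cot h)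
  refine h1.congr_of_eventuallyEq ?_
  filter_upwards [extChartAt_source_mem_nhds' h] with z hz
  exact (localRep_extChartAt hz g).symm

/-- The Hamiltonian vector field, as a vector of the model space. -/
def hamVec (g : CotangentBundle n M → ℝ) (ℓ : CotangentBundle n M) : PhaseModel n := hamVF g ℓ

/-- Both sides represent the differential of `g` through `σ`. The chart preserves `σ`, and `σ` is
nondegenerate. -/
theorem chartDiff_hamVec (h : ℓ ∈ (extChartAt (cotModel n) c).source)
    {g : CotangentBundle n M → ℝ}
    (hg : DifferentiableAt ℝ (localRep c g) (extChartAt (cotModel n) c ℓ)) :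
    chartDiff c ℓ (hamVec g ℓ) = flatHamVF (localRep c g) (extChartAt (cotModel n) c ℓ) := by
  rw [← sub_eq_zero]
  refine stdSymp_nondegenerate fun Y => ?_
  obtain ⟨e, he⟩ := chartDiff_isInvertible h
  obtain ⟨X, rfl⟩ : ∃ X, chartDiff c ℓ X = Y := ⟨e.symm Y, by rw [← he]; simp⟩
  have h1 : mfderiv (cotModel n) 𝓘(ℝ, ℝ) g ℓ X = stdSymp X (hamVec g ℓ) :=
    mfderiv_eq_symplecticForm_hamVF g ℓ X
  rw [(hasMFDerivAt_of_localRep h hg).mfderiv] at h1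
  rw [map_sub, stdSymp_chartDiff h, stdSymp_flatHamVF, ← h1]
  exact sub_self _

theorem poisson_eq_flatPoisson (h : ℓ ∈ (extChartAt (cotModel n) c).source)
    {a b : CotangentBundle n M → ℝ}
    (ha : DifferentiableAt ℝ (localRep c a) (extChartAt (cotModel n) c ℓ))
    (hb : DifferentiableAt ℝ (localRep c b) (extChartAt (cotModel n) c ℓ)) :
    poisson a b ℓ = flatPoisson (localRep c a) (localRep c b) (extChartAt (cotModel n) c ℓ) := by
  rw [poisson, (hasMFDerivAt_of_localRep h hb).mfderiv, flatPoisson, ← chartDiff_hamVec h ha]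
  rfl

/-- In canonical coordinates the function is `(q, p) ↦ p (X(q))`, where `X(q)` is the smooth local
expression of the field in the chart of `M`. -/
theorem contDiffOn_localRep_linHam {X : ∀ x : M, TangentSpace (𝓡 n) x} (hX : IsSmoothVF X)
    (c : CotangentBundle n M) :
    ContDiffOn ℝ ∞ (localRep c (linHam X)) (extChartAt (cotModel n) c).target := by
  let e := trivializationAt (EuclideanSpace ℝ (Fin n)) (TangentSpace (𝓡 n) : M → Type _) c.1
  have h1 : ContMDiffOn (𝓡 n) 𝓘(ℝ, EuclideanSpace ℝ (Fin n)) ∞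
      (fun x => (e ⟨x, X x⟩).2) e.baseSet :=
    (e.contMDiffOn_section_baseSet_iff (IB := 𝓡 n)).mp hX.contMDiffOn
  have h2 : ContDiffOn ℝ ∞
      ((fun x => (e ⟨x, X x⟩).2) ∘ (extChartAt (𝓡 n) c.1).symm) (extChartAt (𝓡 n) c.1).target := by
    rw [← contMDiffOn_iff_contDiffOn]
    refine h1.comp (contMDiffOn_extChartAt_symm c.1) fun q hq => ?_
    have := (extChartAt (𝓡 n) c.1).map_target hq
    rwa [extChartAt_source] at this
  have h3 : ContDiffOn ℝ ∞ (fun y : PhaseModel n =>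
      y.2 (((fun x => (e ⟨x, X x⟩).2) ∘ (extChartAt (𝓡 n) c.1).symm) y.1))
      (extChartAt (cotModel n) c).target :=
    contDiff_snd.contDiffOn.clm_apply
      (h2.comp contDiff_fst.contDiffOn fun y hy => mem_extChartAt_cot_target.mp hy)
  refine h3.congr fun y hy => ?_
  obtain ⟨ℓ, hℓ, rfl⟩ : ∃ ℓ ∈ (extChartAt (cotModel n) c).source, extChartAt (cotModel n) c ℓ = y :=
    ⟨_, (extChartAt (cotModel n) c).map_target hy, (extChartAt (cotModel n) c).right_inv hy⟩
  have hℓ' := mem_extChartAt_cot_source.mp hℓ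
  rw [localRep_extChartAt hℓ, extChartAt_cot_snd hℓ, extChartAt_cot_fst, Function.comp_apply,
    (extChartAt (𝓡 n) c.1).left_inv hℓ']
  have he : (e ⟨ℓ.1, X ℓ.1⟩).2 = tangentCoordChange (𝓡 n) ℓ.1 c.1 ℓ.1 (X ℓ.1) := rfl
  have hcomp : tangentCoordChange (𝓡 n) c.1 ℓ.1 ℓ.1 ((e ⟨ℓ.1, X ℓ.1⟩).2) = X ℓ.1 := by
    rw [he]
    exact (tangentCoordChange_comp ⟨⟨mem_extChartAt_source ℓ.1, hℓ'⟩,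
      mem_extChartAt_source ℓ.1⟩).trans (tangentCoordChange_self (mem_extChartAt_source ℓ.1))
  exact congrArg ℓ.2 hcomp.symm

end LocalRep

/-! ### Carathéodory equations: estimates, resolvents, conserved forms -/

section CaratheodoryODE

variable {E : Type*} [NormedAddCommGroup E] [NormedSpace ℝ E]

theorem norm_integral_le_of_mem_Icc {a b τ K : ℝ} {g : ℝ → E} (hτ : τ ∈ Icc a b)
    (h : ∀ σ ∈ Icc a b, ‖g σ‖ ≤ K) : ‖∫ σ in a..τ, g σ‖ ≤ K * (τ - a) := by
  have := intervalIntegral.norm_integral_le_of_norm_le_const (a := a) (b := τ) (f := g) (C := K)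
    fun σ hσ => h σ (by
      rw [uIoc_of_le hτ.1] at hσ
      exact ⟨hσ.1.le, hσ.2.trans hτ.2⟩)
  rwa [abs_of_nonneg (sub_nonneg.mpr hτ.1)] at this

theorem intervalIntegrable_of_mem_Icc {a b p q : ℝ} {g : ℝ → E}
    (hg : IntervalIntegrable g volume a b) (hp : p ∈ Icc a b) (hq : q ∈ Icc a b) :
    IntervalIntegrable g volume p q := by
  refine hg.mono_set ?_
  rw [uIcc_of_le (hp.1.trans hp.2)]
  exact uIcc_subset_Icc hp hq

theorem continuousOn_primitive_Icc {a b : ℝ} (hab : a ≤ b) {g : ℝ → E}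
    (hg : IntervalIntegrable g volume a b) :
    ContinuousOn (fun τ => ∫ σ in a..τ, g σ) (Icc a b) := by
  have := intervalIntegral.continuousOn_primitive_interval' hg (left_mem_uIcc (a := a) (b := b))
  rwa [uIcc_of_le hab] at this

/-- A bound which improves under halving holds. -/
theorem norm_le_of_forall_norm_le_add_half {a b K : ℝ} {w : ℝ → E} (hw : ContinuousOn w (Icc a b))
    (h : ∀ S, (∀ σ ∈ Icc a b, ‖w σ‖ ≤ S) → ∀ τ ∈ Icc a b, ‖w τ‖ ≤ K + S / 2) :
    ∀ τ ∈ Icc a b, ‖w τ‖ ≤ 2 * K := by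
  intro τ hτ
  -- The maximum `S` of `‖w‖` is attained, so the hypothesis at that point reads `S ≤ K + S / 2`.
  obtain ⟨x, hx, hmax⟩ := isCompact_Icc.exists_isMaxOn ⟨τ, hτ⟩ hw.norm
  have h1 := h ‖w x‖ (fun σ hσ => hmax hσ) x hx
  have h2 : ‖w τ‖ ≤ ‖w x‖ := hmax hτ
  linarith

theorem lipschitzOnWith_primitive {a b : ℝ} {K : NNReal} {g : ℝ → E}
    (hg : IntervalIntegrable g volume a b) (hK : ∀ σ ∈ Icc a b, ‖g σ‖ ≤ K) :
    LipschitzOnWith K (fun τ => ∫ σ in a..τ, g σ) (Icc a b) := by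
  refine LipschitzOnWith.of_dist_le_mul fun x hx y hy => ?_
  have ha : a ∈ Icc a b := ⟨le_rfl, hx.1.trans hx.2⟩
  rw [dist_eq_norm, intervalIntegral.integral_interval_sub_left
    (intervalIntegrable_of_mem_Icc hg ha hx) (intervalIntegrable_of_mem_Icc hg ha hy),
    Real.dist_eq]
  exact intervalIntegral.norm_integral_le_of_norm_le_const fun σ hσ =>
    hK σ (uIcc_subset_Icc hy hx (uIoc_subset_uIcc hσ))

/-- Fundamental theorem of calculus for an absolutely continuous curve with bounded derivative. -/
theorem AbsolutelyContinuousOnInterval.eq_add_integral_of_bounded [CompleteSpace E] {a b K : ℝ}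
    (hab : a ≤ b) {y g : ℝ → E} (hy : AbsolutelyContinuousOnInterval y a b)
    (hg : IntervalIntegrable g volume a b) (hK : ∀ σ ∈ Icc a b, ‖g σ‖ ≤ K)
    (hd : ∀ᵐ σ, σ ∈ Ioo a b → HasDerivAt y (g σ) σ) :
    ∀ τ ∈ Icc a b, y τ = y a + ∫ σ in a..τ, g σ := by
  have hL := lipschitzOnWith_primitive hg (K := K.toNNReal)
    fun σ hσ => (hK σ hσ).trans (Real.le_coe_toNNReal K)
  rw [← uIcc_of_le hab] at hL
  obtain ⟨C, hC⟩ := (hy.sub hL.absolutelyContinuousOnInterval).const_of_ae_hasDerivAt_zero (by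
    have hne : ∀ᵐ σ : ℝ, σ ≠ a ∧ σ ≠ b :=
      (Measure.ae_ne volume a).and (Measure.ae_ne volume b)
    filter_upwards [hd, hg.ae_hasDerivAt_integral, hne] with σ h1 h2 h3 hσ
    rw [uIcc_of_le hab] at hσ h2
    have hσ' : σ ∈ Ioo a b := ⟨lt_of_le_of_ne hσ.1 h3.1.symm, lt_of_le_of_ne hσ.2 h3.2⟩
    simpa using (h1 hσ').sub (h2 hσ a ⟨le_rfl, hab⟩))
  rw [uIcc_of_le hab] at hC
  intro τ hτ
  have e1 := hC τ hτ
  have e2 := hC a ⟨le_rfl, hab⟩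
  simp only [Pi.sub_apply, intervalIntegral.integral_same, sub_zero] at e1 e2
  rw [e2, ← e1]
  abel

variable [CompleteSpace E]

/-- `R` is the resolvent, starting at time `a`, of the linear equation with coefficient `A`. -/
structure IsResolvent (A : ℝ → E →L[ℝ] E) (a b : ℝ) (R : ℝ → E →L[ℝ] E) : Prop where
  continuousOn : ContinuousOn R (Icc a b)
  eq_integral : ∀ τ ∈ Icc a b, R τ = 1 + ∫ σ in a..τ, A σ * R σ
  norm_le : ∀ τ ∈ Icc a b, ‖R τ‖ ≤ 2

/-- Banach's fixed point theorem for the Picard operator on `C([a, b])`, which the smallness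
condition makes a `1/4`-contraction. The same condition absorbs the integral term in the bound `‖R‖
≤ 2`. -/
theorem exists_isResolvent {A : ℝ → E →L[ℝ] E} {a b C : ℝ} (hab : a ≤ b)
    (hA : IntervalIntegrable A volume a b) (hC : ∀ σ ∈ Icc a b, ‖A σ‖ ≤ C)
    (hsmall : C * (b - a) ≤ 1 / 4) : ∃ R, IsResolvent A a b R := by
  have hC0 : 0 ≤ C := (norm_nonneg _).trans (hC a ⟨le_rfl, hab⟩)
  have hint : ∀ f : C(Icc a b, E →L[ℝ] E),
      IntervalIntegrable (fun σ => A σ * IccExtend hab f σ) volume a b := fun f =>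
    hA.mul_continuousOn (f.continuous.Icc_extend' ).continuousOn
  let P : C(Icc a b, E →L[ℝ] E) → C(Icc a b, E →L[ℝ] E) := fun f =>
    ⟨fun τ => 1 + ∫ σ in a..τ, A σ * IccExtend hab f σ,
      continuous_const.add (continuousOn_iff_continuous_domRestrict.mp
        (continuousOn_primitive_Icc hab (hint f)))⟩
  have hP : ContractingWith (1 / 4) P := by
    refine ⟨by rw [← NNReal.coe_lt_coe]; norm_num, LipschitzWith.of_dist_le_mul fun f g => ?_⟩
    rw [ContinuousMap.dist_le (by positivity)]
    intro τ
    have ha : a ∈ Icc a b := ⟨le_rfl, hab⟩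
    have h1 : P f τ - P g τ = ∫ σ in a..τ, A σ * (IccExtend hab f σ - IccExtend hab g σ) := by
      simp only [P, ContinuousMap.coe_mk, add_sub_add_left_eq_sub, mul_sub]
      exact (intervalIntegral.integral_sub (intervalIntegrable_of_mem_Icc (hint f) ha τ.2)
        (intervalIntegrable_of_mem_Icc (hint g) ha τ.2)).symm
    rw [dist_eq_norm, h1]
    refine (norm_integral_le_of_mem_Icc τ.2 (K := C * dist f g) fun σ hσ => ?_).trans ?_
    · refine (norm_mul_le _ _).trans (mul_le_mul (hC σ hσ) ?_ (norm_nonneg _) hC0)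
      rw [← dist_eq_norm]
      exact ContinuousMap.dist_apply_le_dist _
    · have h2 : C * (τ - a) ≤ 1 / 4 :=
        (mul_le_mul_of_nonneg_left (by linarith [τ.2.2]) hC0).trans hsmall
      calc C * dist f g * (τ - a) = C * (τ - a) * dist f g := by ring
        _ ≤ 1 / 4 * dist f g := mul_le_mul_of_nonneg_right h2 dist_nonneg
        _ = _ := by simp
  have hfix : P (hP.fixedPoint P) = hP.fixedPoint P := hP.fixedPoint_isFixedPt
  set f := hP.fixedPoint P with hf
  have hR : ContinuousOn (IccExtend hab f) (Icc a b) := f.continuous.Icc_extend'.continuousOn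
  have heq : ∀ τ ∈ Icc a b, IccExtend hab f τ = 1 + ∫ σ in a..τ, A σ * IccExtend hab f σ := by
    intro τ hτ
    have := congrArg (fun g : C(Icc a b, E →L[ℝ] E) => g ⟨τ, hτ⟩) hfix
    rw [IccExtend_of_mem hab _ hτ]
    exact this.symm
  refine ⟨IccExtend hab f, hR, heq, fun τ hτ => ?_⟩
  refine (norm_le_of_forall_norm_le_add_half hR (K := 1) (fun S hS τ hτ => ?_) τ hτ).trans
    (by norm_num)
  have hS0 : 0 ≤ S := (norm_nonneg _).trans (hS τ hτ)
  rw [heq τ hτ]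
  refine (norm_add_le _ _).trans (add_le_add ContinuousLinearMap.norm_id_le ?_)
  refine (norm_integral_le_of_mem_Icc hτ (K := C * S) fun σ hσ => ?_).trans ?_
  · exact (norm_mul_le _ _).trans (mul_le_mul (hC σ hσ) (hS σ hσ) (norm_nonneg _) hC0)
  · have h2 : C * (τ - a) ≤ 1 / 4 :=
      (mul_le_mul_of_nonneg_left (by linarith [hτ.2]) hC0).trans hsmall
    nlinarith

/-- `y` is a Carathéodory solution on `[a, b]` of `ẏ = F t y`, in integral form. -/
structure IsIntegralSolution (F : ℝ → E → E) (a b : ℝ) (y : ℝ → E) : Prop where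
  continuousOn : ContinuousOn y (Icc a b)
  integrable : IntervalIntegrable (fun σ => F σ (y σ)) volume a b
  eq_integral : ∀ τ ∈ Icc a b, y τ = y a + ∫ σ in a..τ, F σ (y σ)

theorem IsIntegralSolution.sub_eq {F : ℝ → E → E} {a b : ℝ} {y z : ℝ → E}
    (hy : IsIntegralSolution F a b y) (hz : IsIntegralSolution F a b z) {τ : ℝ}
    (hτ : τ ∈ Icc a b) :
    z τ - y τ = (z a - y a) + ∫ σ in a..τ, (F σ (z σ) - F σ (y σ)) := by
  have ha : a ∈ Icc a b := ⟨le_rfl, hτ.1.trans hτ.2⟩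
  rw [intervalIntegral.integral_sub (intervalIntegrable_of_mem_Icc hz.integrable ha hτ)
    (intervalIntegrable_of_mem_Icc hy.integrable ha hτ), hy.eq_integral τ hτ,
    hz.eq_integral τ hτ]
  abel

/-- Replaces Grönwall's inequality on short intervals: the integral term is at most a quarter of the
supremum and is absorbed. The Lipschitz bound is required only along the two curves, since the
fields are controlled only inside a chart. -/
theorem IsIntegralSolution.norm_sub_le {F : ℝ → E → E} {a b C : ℝ} {y z : ℝ → E}
    (hy : IsIntegralSolution F a b y) (hz : IsIntegralSolution F a b z)
    (hC0 : 0 ≤ C) (hsmall : C * (b - a) ≤ 1 / 4)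
    (hC : ∀ σ ∈ Icc a b, ‖F σ (z σ) - F σ (y σ)‖ ≤ C * ‖z σ - y σ‖) :
    ∀ τ ∈ Icc a b, ‖z τ - y τ‖ ≤ 2 * ‖z a - y a‖ := by
  refine norm_le_of_forall_norm_le_add_half (hz.continuousOn.sub hy.continuousOn)
    fun S hS τ hτ => ?_
  have hS0 : 0 ≤ S := (norm_nonneg _).trans (hS τ hτ)
  change ‖z τ - y τ‖ ≤ _
  rw [hy.sub_eq hz hτ]
  refine (norm_add_le _ _).trans (add_le_add_right ?_ _)
  refine (norm_integral_le_of_mem_Icc hτ (K := C * S) fun σ hσ => ?_).trans ?_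
  · exact (hC σ hσ).trans (mul_le_mul_of_nonneg_left (hS σ hσ) hC0)
  · have h2 : C * (τ - a) ≤ 1 / 4 :=
      (mul_le_mul_of_nonneg_left (by linarith [hτ.2]) hC0).trans hsmall
    nlinarith

/-- The resolvent of the linearized equation is the derivative of the flow. -/
theorem IsIntegralSolution.norm_sub_resolvent_le {F : ℝ → E → E} {A R : ℝ → E →L[ℝ] E}
    {a b C ε : ℝ} {y z : ℝ → E} (hR : IsResolvent A a b R)
    (hA : IntervalIntegrable A volume a b) (hAC : ∀ σ ∈ Icc a b, ‖A σ‖ ≤ C)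
    (hy : IsIntegralSolution F a b y) (hz : IsIntegralSolution F a b z)
    (hC0 : 0 ≤ C) (hε : 0 ≤ ε) (hsmall : C * (b - a) ≤ 1 / 4)
    (hC : ∀ σ ∈ Icc a b, ‖F σ (z σ) - F σ (y σ)‖ ≤ C * ‖z σ - y σ‖)
    (hd : ∀ σ ∈ Icc a b, ‖F σ (z σ) - F σ (y σ) - A σ (z σ - y σ)‖ ≤ ε * ‖z σ - y σ‖) :
    ∀ τ ∈ Icc a b, ‖z τ - y τ - R τ (z a - y a)‖ ≤ 4 * ε * (b - a) * ‖z a - y a‖ := by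
  have hbd := hy.norm_sub_le hz hC0 hsmall hC
  set w := z a - y a with hw
  -- The linearization defect is at most `ε ‖z - y‖ ≤ 2 ε ‖w‖`. Integration contributes the factor
  -- `b - a`, and the halving argument doubles the constant to `4 ε`.
  have key := norm_le_of_forall_norm_le_add_half (a := a) (b := b)
    (w := fun τ => z τ - y τ - R τ w) (K := 2 * ε * (b - a) * ‖w‖)
    ((hz.continuousOn.sub hy.continuousOn).sub (hR.continuousOn.clm_apply continuousOn_const))
    (fun S hS τ hτ => ?_)
  · intro τ hτ
    refine (key τ hτ).trans (le_of_eq (by ring))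
  have hS0 : 0 ≤ S := (norm_nonneg _).trans (hS τ hτ)
  have hab : a ≤ b := hτ.1.trans hτ.2
  have ha : a ∈ Icc a b := ⟨le_rfl, hab⟩
  have i1 : IntervalIntegrable (fun σ => F σ (z σ) - F σ (y σ)) volume a τ :=
    intervalIntegrable_of_mem_Icc (hz.integrable.sub hy.integrable) ha hτ
  have i2 : IntervalIntegrable (fun σ => A σ * R σ) volume a τ :=
    intervalIntegrable_of_mem_Icc (hA.mul_continuousOn
      (by rw [uIcc_of_le hab]; exact hR.continuousOn)) ha hτ
  have i3 : IntervalIntegrable (fun σ => (A σ * R σ) w) volume a τ :=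
    ⟨(ContinuousLinearMap.apply ℝ E w).integrable_comp i2.1,
      (ContinuousLinearMap.apply ℝ E w).integrable_comp i2.2⟩
  have hRw : R τ w = w + ∫ σ in a..τ, (A σ * R σ) w := by
    rw [hR.eq_integral τ hτ, add_apply, one_apply_eq_self,
      ContinuousLinearMap.intervalIntegral_apply i2]
  have he : z τ - y τ - R τ w = ∫ σ in a..τ, (F σ (z σ) - F σ (y σ) - (A σ * R σ) w) := by
    rw [intervalIntegral.integral_sub i1 i3, hy.sub_eq hz hτ, hRw, ← hw]
    abel
  change ‖z τ - y τ - R τ w‖ ≤ _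
  rw [he]
  refine (norm_integral_le_of_mem_Icc hτ (K := ε * (2 * ‖w‖) + C * S) fun σ hσ => ?_).trans ?_
  · have h1 : F σ (z σ) - F σ (y σ) - (A σ * R σ) w = (F σ (z σ) - F σ (y σ) - A σ (z σ - y σ))
        + A σ (z σ - y σ - R σ w) := by
      simp only [map_sub, mul_apply_eq_comp]
      abel
    rw [h1]
    refine (norm_add_le _ _).trans (add_le_add ?_ ?_)
    · exact (hd σ hσ).trans (mul_le_mul_of_nonneg_left (hbd σ hσ) hε)
    · exact ((A σ).le_opNorm _).trans
        (mul_le_mul (hAC σ hσ) (hS σ hσ) (norm_nonneg _) hC0)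
  · have h2 : C * (τ - a) ≤ 1 / 4 :=
      (mul_le_mul_of_nonneg_left (by linarith [hτ.2]) hC0).trans hsmall
    have h3 : ε * (2 * ‖w‖) * (τ - a) ≤ ε * (2 * ‖w‖) * (b - a) :=
      mul_le_mul_of_nonneg_left (by linarith [hτ.2]) (by positivity)
    nlinarith

/-- The resolvent of an equation with coefficients skew for a bilinear form preserves the form. -/
theorem IsResolvent.preserves_form {A R : ℝ → E →L[ℝ] E} {a b C : ℝ} (hR : IsResolvent A a b R)
    (hab : a ≤ b) (hA : IntervalIntegrable A volume a b) (hAC : ∀ σ ∈ Icc a b, ‖A σ‖ ≤ C)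
    (B : E →L[ℝ] E →L[ℝ] ℝ)
    (hB : ∀ σ ∈ Icc a b, ∀ v w, B (A σ v) w + B v (A σ w) = 0) :
    ∀ τ ∈ Icc a b, ∀ v w, B (R τ v) (R τ w) = B v w := by
  have ha : a ∈ Icc a b := ⟨le_rfl, hab⟩
  have hC0 : 0 ≤ C := (norm_nonneg _).trans (hAC a ha)
  intro τ hτ v w
  have hint : IntervalIntegrable (fun σ => A σ * R σ) volume a b :=
    hA.mul_continuousOn (by rw [uIcc_of_le hab]; exact hR.continuousOn)
  have hbd : ∀ σ ∈ Icc a b, ‖A σ * R σ‖ ≤ (C * 2).toNNReal := fun σ hσ =>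
    ((norm_mul_le _ _).trans (mul_le_mul (hAC σ hσ) (hR.norm_le σ hσ) (norm_nonneg _)
      hC0)).trans (Real.le_coe_toNNReal _)
  have hL := lipschitzOnWith_primitive hint hbd
  have hRL : LipschitzOnWith (C * 2).toNNReal R (Icc a b) := by
    refine LipschitzOnWith.of_dist_le_mul fun x hx y hy => ?_
    rw [hR.eq_integral x hx, hR.eq_integral y hy, dist_add_left]
    exact hL.dist_le_mul x hx y hy
  -- The Lipschitz constant comes from the product rule for differences: two terms, each with a
  -- factor `‖R‖ ≤ 2`, times the Lipschitz constant `2 C` of `R`.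
  have hac : AbsolutelyContinuousOnInterval (fun σ => B (R σ v) (R σ w)) a b := by
    refine LipschitzOnWith.absolutelyContinuousOnInterval
      (K := (4 * ‖B‖ * ‖v‖ * ‖w‖).toNNReal * (C * 2).toNNReal) ?_
    rw [uIcc_of_le hab]
    refine LipschitzOnWith.of_dist_le_mul fun x hx y hy => ?_
    have h1 : B (R x v) (R x w) - B (R y v) (R y w)
        = B ((R x - R y) v) (R x w) + B (R y v) ((R x - R y) w) := by
      simp only [sub_apply, map_sub]
      abel
    have hd : ‖R x - R y‖ ≤ (C * 2).toNNReal * dist x y := by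
      rw [← dist_eq_norm]; exact hRL.dist_le_mul x hx y hy
    have h2 : ∀ p q : E →L[ℝ] E, |B (p v) (q w)| ≤ ‖B‖ * ‖v‖ * ‖w‖ * (‖p‖ * ‖q‖) := by
      intro p q
      calc |B (p v) (q w)| ≤ ‖B‖ * ‖p v‖ * ‖q w‖ := B.le_opNorm₂ _ _
        _ ≤ ‖B‖ * (‖p‖ * ‖v‖) * (‖q‖ * ‖w‖) := by
          gcongr <;> exact ContinuousLinearMap.le_opNorm _ _
        _ = _ := by ring
    rw [Real.dist_eq, h1]
    refine (abs_add_le _ _).trans ((add_le_add (h2 _ _) (h2 _ _)).trans ?_)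
    have hx2 := hR.norm_le x hx
    have hy2 := hR.norm_le y hy
    push_cast
    calc ‖B‖ * ‖v‖ * ‖w‖ * (‖R x - R y‖ * ‖R x‖) + ‖B‖ * ‖v‖ * ‖w‖ * (‖R y‖ * ‖R x - R y‖)
        ≤ ‖B‖ * ‖v‖ * ‖w‖ * (‖R x - R y‖ * 2) + ‖B‖ * ‖v‖ * ‖w‖ * (2 * ‖R x - R y‖) := by
          gcongr
      _ = 4 * ‖B‖ * ‖v‖ * ‖w‖ * ‖R x - R y‖ := by ring
      _ ≤ 4 * ‖B‖ * ‖v‖ * ‖w‖ * ((C * 2).toNNReal * dist x y) := by gcongr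
      _ ≤ _ := by
        rw [← mul_assoc]
        gcongr
        exact Real.le_coe_toNNReal _
  obtain ⟨c, hc⟩ := hac.const_of_ae_hasDerivAt_zero (by
    have hne : ∀ᵐ σ : ℝ, σ ≠ a ∧ σ ≠ b :=
      (Measure.ae_ne volume a).and (Measure.ae_ne volume b)
    filter_upwards [hint.ae_hasDerivAt_integral, hne] with σ h2 h3 hσ
    rw [uIcc_of_le hab] at hσ h2
    have hσ' : σ ∈ Ioo a b := ⟨lt_of_le_of_ne hσ.1 h3.1.symm, lt_of_le_of_ne hσ.2 h3.2⟩
    have hRd : HasDerivAt R (A σ * R σ) σ := by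
      refine ((h2 hσ a ha).const_add 1).congr_of_eventuallyEq ?_
      filter_upwards [Icc_mem_nhds hσ'.1 hσ'.2] with x hx
      exact hR.eq_integral x hx
    have hv : ∀ x : E, HasDerivAt (fun s => R s x) ((A σ * R σ) x) σ := fun x => by
      simpa using hRd.clm_apply (hasDerivAt_const σ x)
    have hBd := (B.hasFDerivAt.comp_hasDerivAt σ (hv v)).clm_apply (hv w)
    refine hBd.congr_deriv ?_
    have := hB σ hσ (R σ v) (R σ w)
    simpa [add_comm] using this)
  rw [uIcc_of_le hab] at hc
  have h1 : R a = 1 := by rw [hR.eq_integral a ha]; simp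
  have := (hc τ hτ).trans (hc a ha).symm
  simpa [h1] using this

end CaratheodoryODE

/-! ### Linear combinations of fields with measurable coefficients -/

section ControlAffineFields

variable {E : Type*} [NormedAddCommGroup E] [NormedSpace ℝ E]

/-- Split `g = g t + (g - g t)`. The first part is a multiple of `∫ v`; the second has primitive
`o(τ - t)`, because `|v| ≤ 1` and `g` is continuous. The condition on `t` thus involves `v` alone
and serves all continuous `g` at once. -/
theorem hasDerivWithinAt_primitive_smul [CompleteSpace E] {v : ℝ → ℝ} {g : ℝ → E} {a b t : ℝ}
    (hv : IntervalIntegrable v volume a b) (hv1 : ∀ σ ∈ Icc a b, |v σ| ≤ 1)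
    (hg : ContinuousOn g (Icc a b)) (ht : t ∈ Icc a b)
    (hV : HasDerivWithinAt (fun τ => ∫ σ in a..τ, v σ) (v t) (Icc a b) t) :
    HasDerivWithinAt (fun τ => ∫ σ in a..τ, v σ • g σ) (v t • g t) (Icc a b) t := by
  have hab : a ≤ b := ht.1.trans ht.2
  have ha : a ∈ Icc a b := ⟨le_rfl, hab⟩
  have hI : IntervalIntegrable (fun σ => v σ • (g σ - g t)) volume a b :=
    hv.smul_continuousOn (by rw [uIcc_of_le hab]; exact hg.sub continuousOn_const)
  have h0 : HasDerivWithinAt (fun τ => ∫ σ in a..τ, v σ • (g σ - g t)) 0 (Icc a b) t := by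
    rw [hasDerivWithinAt_iff_isLittleO, Asymptotics.isLittleO_iff]
    intro ε hε
    obtain ⟨δ, hδ, hgδ⟩ := Metric.continuousWithinAt_iff.mp (hg t ht) ε hε
    filter_upwards [self_mem_nhdsWithin, mem_nhdsWithin_of_mem_nhds (Metric.ball_mem_nhds t hδ)]
      with τ hτ hτδ
    rw [intervalIntegral.integral_interval_sub_left (intervalIntegrable_of_mem_Icc hI ha hτ)
      (intervalIntegrable_of_mem_Icc hI ha ht), smul_zero, sub_zero, Real.norm_eq_abs]
    refine intervalIntegral.norm_integral_le_of_norm_le_const fun σ hσ => ?_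
    have hσ' := uIoc_subset_uIcc hσ
    have hσm := uIcc_subset_Icc ht hτ hσ'
    have hd : dist σ t < δ :=
      lt_of_le_of_lt (by
        rw [Real.dist_eq, Real.dist_eq]
        exact abs_sub_left_of_mem_uIcc hσ') (Metric.mem_ball.mp hτδ)
    rw [norm_smul, Real.norm_eq_abs]
    have h2 := (hgδ hσm hd).le
    rw [dist_eq_norm] at h2
    calc |v σ| * ‖g σ - g t‖ ≤ 1 * ε :=
          mul_le_mul (hv1 σ hσm) h2 (norm_nonneg _) zero_le_one
      _ = ε := one_mul ε
  have h1 := (hV.smul_const (g t)).add h0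
  rw [add_zero] at h1
  refine h1.congr_of_mem (fun τ hτ => ?_) ht
  have i1 : IntervalIntegrable (fun σ => v σ • g t) volume a τ :=
    intervalIntegrable_of_mem_Icc (hv.smul_continuousOn continuousOn_const) ha hτ
  rw [Pi.add_apply, ← intervalIntegral.integral_smul_const, ← intervalIntegral.integral_add i1
    (intervalIntegrable_of_mem_Icc hI ha hτ)]
  simp [smul_sub]

theorem exists_bounds_on_closedBall [ProperSpace E] {X : E → E} {Ω : Set E} (hΩ : IsOpen Ω)
    (hX : ContDiffOn ℝ ∞ X Ω) {y₀ : E} {r : ℝ} (hball : Metric.closedBall y₀ r ⊆ Ω) :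
    (∃ C, 0 ≤ C ∧ ∀ z ∈ Metric.closedBall y₀ r, ‖X z‖ ≤ C ∧ ‖fderiv ℝ X z‖ ≤ C) ∧
    ∀ ε > 0, ∃ δ > 0, ∀ z ∈ Metric.closedBall y₀ r, ∀ z' ∈ Metric.closedBall y₀ r, ‖z - z'‖ ≤ δ →
      ‖X z - X z' - fderiv ℝ X z' (z - z')‖ ≤ ε * ‖z - z'‖ := by
  have hK : IsCompact (Metric.closedBall y₀ r) := isCompact_closedBall y₀ r
  have hc : ContinuousOn X (Metric.closedBall y₀ r) := hX.continuousOn.mono hball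
  have hc' : ContinuousOn (fderiv ℝ X) (Metric.closedBall y₀ r) :=
    (hX.continuousOn_fderiv_of_isOpen hΩ (by norm_cast)).mono hball
  have hd : ∀ z ∈ Metric.closedBall y₀ r, DifferentiableAt ℝ X z := fun z hz =>
    (hX.contDiffAt (hΩ.mem_nhds (hball hz))).differentiableAt (by simp)
  constructor
  · obtain ⟨C1, h1⟩ := hK.exists_bound_of_continuousOn hc
    obtain ⟨C2, h2⟩ := hK.exists_bound_of_continuousOn hc'
    exact ⟨max 0 (max C1 C2), le_max_left _ _, fun z hz =>
      ⟨(h1 z hz).trans ((le_max_left _ _).trans (le_max_right _ _)),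
        (h2 z hz).trans ((le_max_right _ _).trans (le_max_right _ _))⟩⟩
  · intro ε hε
    obtain ⟨δ, hδ, hu⟩ := Metric.uniformContinuousOn_iff.mp
      (hK.uniformContinuousOn_of_continuous hc') ε hε
    refine ⟨δ / 2, by positivity, fun z hz z' hz' hzz => ?_⟩
    -- On this convex set `fderiv X` differs from its value at `z'` by less than `ε`, by uniform
    -- continuity on the compact ball. The mean value inequality then gives a first-order estimate
    -- uniform in `z'`.
    have hconv : Convex ℝ (Metric.closedBall y₀ r ∩ Metric.closedBall z' (δ / 2)) :=
      (convex_closedBall _ _).inter (convex_closedBall _ _)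
    refine hconv.norm_image_sub_le_of_norm_fderiv_le' (fun x hx => hd x hx.1) (fun x hx => ?_)
      ⟨hz', Metric.mem_closedBall_self (by positivity)⟩
      ⟨hz, by rwa [Metric.mem_closedBall, dist_eq_norm]⟩
    rw [← dist_eq_norm]
    exact (hu x hx.1 z' hz' (lt_of_le_of_lt hx.2 (by linarith))).le

variable {ι : Type*} [Fintype ι]

/-- A linear combination of vector fields. -/
def combField (X : ι → E → E) (v : ι → ℝ) (z : E) : E := ∑ j, v j • X j z

/-- The differential of a linear combination of vector fields. -/
def combDiff (X : ι → E → E) (v : ι → ℝ) (z : E) : E →L[ℝ] E := ∑ j, v j • fderiv ℝ (X j) z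

theorem combDiff_apply (X : ι → E → E) (v : ι → ℝ) (z w : E) :
    combDiff X v z w = ∑ j, v j • fderiv ℝ (X j) z w := by
  simp [combDiff]

/-- Uniform bounds, on a ball around `y₀`, on the linear combinations of the fields `X j` with
coefficients in `[-1, 1]`. -/
structure IsFlowBox (X : ι → E → E) (Ω : Set E) (y₀ : E) (ρ C : ℝ) : Prop where
  pos : 0 < ρ
  nonneg : 0 ≤ C
  subset : Metric.closedBall y₀ (2 * ρ) ⊆ Ω
  norm_le : ∀ v : ι → ℝ, (∀ j, |v j| ≤ 1) → ∀ z ∈ Metric.closedBall y₀ (2 * ρ),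
    ‖combField X v z‖ ≤ C
  norm_diff_le : ∀ v : ι → ℝ, (∀ j, |v j| ≤ 1) → ∀ z ∈ Metric.closedBall y₀ (2 * ρ),
    ‖combDiff X v z‖ ≤ C
  lipschitz : ∀ v : ι → ℝ, (∀ j, |v j| ≤ 1) → ∀ z ∈ Metric.closedBall y₀ (2 * ρ),
    ∀ z' ∈ Metric.closedBall y₀ (2 * ρ), ‖combField X v z - combField X v z'‖ ≤ C * ‖z - z'‖
  differentiable : ∀ ε > 0, ∃ δ > 0, ∀ v : ι → ℝ, (∀ j, |v j| ≤ 1) →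
    ∀ z ∈ Metric.closedBall y₀ (2 * ρ), ∀ z' ∈ Metric.closedBall y₀ (2 * ρ), ‖z - z'‖ ≤ δ →
      ‖combField X v z - combField X v z' - combDiff X v z' (z - z')‖ ≤ ε * ‖z - z'‖

theorem exists_isFlowBox [ProperSpace E] {X : ι → E → E} {Ω : Set E} (hΩ : IsOpen Ω)
    (hX : ∀ j, ContDiffOn ℝ ∞ (X j) Ω) {y₀ : E} (hy : y₀ ∈ Ω) : ∃ ρ C, IsFlowBox X Ω y₀ ρ C := by
  obtain ⟨r, hr, hball⟩ := Metric.nhds_basis_closedBall.mem_iff.mp (hΩ.mem_nhds hy)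
  -- The reference curve will be kept within radius `ρ` of the centre; the remaining width `ρ` is
  -- left to the neighbouring solutions.
  have hρ : 2 * (r / 2) = r := by ring
  have hB := fun j => exists_bounds_on_closedBall hΩ (hX j) hball
  choose C hC0 hC using fun j => (hB j).1
  have hsum : ∀ (v : ι → ℝ), (∀ j, |v j| ≤ 1) → ∀ {G : Type _} [NormedAddCommGroup G]
      [NormedSpace ℝ G] (g : ι → G) (K : ι → ℝ), (∀ j, ‖g j‖ ≤ K j) →
      ‖∑ j, v j • g j‖ ≤ ∑ j, K j := by
    intro v hv G _ _ g K hg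
    refine (norm_sum_le _ _).trans (Finset.sum_le_sum fun j _ => ?_)
    rw [norm_smul, Real.norm_eq_abs]
    calc |v j| * ‖g j‖ ≤ 1 * ‖g j‖ := mul_le_mul_of_nonneg_right (hv j) (norm_nonneg _)
      _ ≤ K j := by rw [one_mul]; exact hg j
  have hdiff : ∀ j, ∀ z ∈ Metric.closedBall y₀ r, DifferentiableAt ℝ (X j) z := fun j z hz =>
    ((hX j).contDiffAt (hΩ.mem_nhds (hball hz))).differentiableAt (by simp)
  refine ⟨r / 2, ∑ j, C j, by positivity, Finset.sum_nonneg fun j _ => hC0 j, ?_, ?_, ?_, ?_, ?_⟩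
  all_goals rw [hρ]
  · exact hball
  · exact fun v hv z hz => hsum v hv _ _ fun j => (hC j z hz).1
  · exact fun v hv z hz => hsum v hv _ _ fun j => (hC j z hz).2
  · intro v hv z hz z' hz'
    rw [combField, combField, ← Finset.sum_sub_distrib, Finset.sum_mul]
    simp only [← smul_sub]
    exact hsum v hv _ _ fun j => (convex_closedBall y₀ r).norm_image_sub_le_of_norm_fderiv_le
      (hdiff j) (fun x hx => (hC j x hx).2) hz' hz
  · intro ε hε
    -- One share of `ε` for each field; the `+ 1` keeps the denominator positive when there are
    -- none.
    have hε' : 0 < ε / (Fintype.card ι + 1) := by positivity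
    choose δ hδ hd using fun j => (hB j).2 _ hε'
    obtain ⟨δ₀, hδ₀, hle⟩ : ∃ δ₀ > 0, ∀ j, δ₀ ≤ δ j := by
      rcases isEmpty_or_nonempty ι with h | h
      · exact ⟨1, one_pos, fun j => h.elim j⟩
      · obtain ⟨i, hi⟩ := Finite.exists_min δ
        exact ⟨δ i, hδ i, hi⟩
    refine ⟨δ₀, hδ₀, fun v hv z hz z' hz' hzz => ?_⟩
    rw [combField, combField, combDiff_apply, ← Finset.sum_sub_distrib, ← Finset.sum_sub_distrib]
    simp only [← smul_sub]
    refine (hsum v hv _ _ fun j => hd j z hz z' hz' (hzz.trans (hle j))).trans ?_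
    rw [Finset.sum_const, Finset.card_univ, nsmul_eq_mul, ← mul_assoc]
    refine mul_le_mul_of_nonneg_right ?_ (norm_nonneg _)
    rw [mul_div_assoc', div_le_iff₀ (by positivity)]
    nlinarith

theorem intervalIntegrable_combField {X : ι → E → E} {Ω : Set E} (hX : ∀ j, ContDiffOn ℝ ∞ (X j) Ω)
    {v : ℝ → ι → ℝ} {a b : ℝ} (hab : a ≤ b)
    (hv : ∀ j, IntervalIntegrable (fun σ => v σ j) volume a b)
    {y : ℝ → E} (hy : ContinuousOn y (Icc a b)) (hm : MapsTo y (Icc a b) Ω) :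
    IntervalIntegrable (fun σ => combField X (v σ) (y σ)) volume a b := by
  have h := IntervalIntegrable.sum Finset.univ (f := fun j σ => v σ j • X j (y σ)) fun j _ =>
    (hv j).smul_continuousOn ?_
  · simpa only [Finset.sum_fn, combField] using h
  rw [uIcc_of_le hab]
  exact (hX j).continuousOn.comp hy hm

theorem intervalIntegrable_combDiff {X : ι → E → E} {Ω : Set E} (hΩ : IsOpen Ω)
    (hX : ∀ j, ContDiffOn ℝ ∞ (X j) Ω)
    {v : ℝ → ι → ℝ} {a b : ℝ} (hab : a ≤ b)
    (hv : ∀ j, IntervalIntegrable (fun σ => v σ j) volume a b)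
    {y : ℝ → E} (hy : ContinuousOn y (Icc a b)) (hm : MapsTo y (Icc a b) Ω) :
    IntervalIntegrable (fun σ => combDiff X (v σ) (y σ)) volume a b := by
  have h := IntervalIntegrable.sum Finset.univ (f := fun j σ => v σ j • fderiv ℝ (X j) (y σ)) fun j _ =>
    (hv j).smul_continuousOn ?_
  · simpa only [Finset.sum_fn, combDiff] using h
  rw [uIcc_of_le hab]
  exact ((hX j).continuousOn_fderiv_of_isOpen hΩ (by norm_cast)).comp hy hm

theorem hasDerivWithinAt_primitive_comb {F : Type*} [NormedAddCommGroup F] [NormedSpace ℝ F]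
    [CompleteSpace F] {v : ℝ → ι → ℝ} {g : ι → ℝ → F} {a b t : ℝ}
    (hv : ∀ j, IntervalIntegrable (fun σ => v σ j) volume a b)
    (hv1 : ∀ σ ∈ Icc a b, ∀ j, |v σ j| ≤ 1)
    (hg : ∀ j, ContinuousOn (g j) (Icc a b)) (ht : t ∈ Icc a b)
    (hV : ∀ j, HasDerivWithinAt (fun τ => ∫ σ in a..τ, v σ j) (v t j) (Icc a b) t) :
    HasDerivWithinAt (fun τ => ∫ σ in a..τ, ∑ j, v σ j • g j σ) (∑ j, v t j • g j t)
      (Icc a b) t := by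
  have hab : a ≤ b := ht.1.trans ht.2
  have h := HasDerivWithinAt.fun_sum (u := Finset.univ) fun j _ =>
    hasDerivWithinAt_primitive_smul (hv j) (fun σ hσ => hv1 σ hσ j) (hg j) ht (hV j)
  refine h.congr_of_mem (fun τ hτ => ?_) ht
  refine intervalIntegral.integral_finsetSum fun j _ => ?_
  refine intervalIntegrable_of_mem_Icc ((hv j).smul_continuousOn ?_) ⟨le_rfl, hab⟩ hτ
  rw [uIcc_of_le hab]
  exact hg j

end ControlAffineFields

/-! ### Differentials of Hamiltonian fields on flat phase space -/

theorem fderiv_clm_comp_apply {E F G : Type*} [NormedAddCommGroup E] [NormedSpace ℝ E]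
    [NormedAddCommGroup F] [NormedSpace ℝ F] [NormedAddCommGroup G] [NormedSpace ℝ G]
    (L : F →L[ℝ] G) {g : E → F} {z : E} (hd : DifferentiableAt ℝ g z) (v : E) :
    fderiv ℝ (fun y => L (g y)) z v = L (fderiv ℝ g z v) := by
  have h := L.hasFDerivAt.comp z hd.hasFDerivAt
  exact congrArg (fun L => L v) h.fderiv

section FlatHamiltonianFields

variable {V : Type*} [NormedAddCommGroup V] [NormedSpace ℝ V] [FiniteDimensional ℝ V]

theorem contDiffOn_flatHamVF {g : V × (V →L[ℝ] ℝ) → ℝ} {Ω : Set (V × (V →L[ℝ] ℝ))}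
    (hΩ : IsOpen Ω) (hg : ContDiffOn ℝ ∞ g Ω) : ContDiffOn ℝ ∞ (flatHamVF g) Ω :=
  symplecticSharp.contDiff.comp_contDiffOn (hg.fderiv_of_isOpen hΩ (by norm_cast))

theorem fderiv_flatHamVF {g : V × (V →L[ℝ] ℝ) → ℝ} {z : V × (V →L[ℝ] ℝ)}
    (hg : ContDiffAt ℝ ∞ g z) (v : V × (V →L[ℝ] ℝ)) :
    fderiv ℝ (flatHamVF g) z v = symplecticSharp (fderiv ℝ (fderiv ℝ g) z v) := by
  have hd : DifferentiableAt ℝ (fderiv ℝ g) z :=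
    (hg.fderiv_right (m := ∞) (by norm_cast)).differentiableAt (by simp)
  exact fderiv_clm_comp_apply (E := V × (V →L[ℝ] ℝ)) (F := (V × (V →L[ℝ] ℝ)) →L[ℝ] ℝ)
    (symplecticSharp (V := V)) hd v

/-- The differential of a Hamiltonian field is skew for the symplectic form. -/
theorem stdSymp_fderiv_flatHamVF_skew {g : V × (V →L[ℝ] ℝ) → ℝ} {z : V × (V →L[ℝ] ℝ)}
    (hg : ContDiffAt ℝ ∞ g z) (v w : V × (V →L[ℝ] ℝ)) :
    stdSymp (fderiv ℝ (flatHamVF g) z v) w + stdSymp v (fderiv ℝ (flatHamVF g) z w) = 0 := by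
  have hsymm : IsSymmSndFDerivAt ℝ g z :=
    (hg.of_le (m := 2) (by norm_cast)).isSymmSndFDerivAt (by simp)
  rw [stdSymp_antisymm, fderiv_flatHamVF hg, fderiv_flatHamVF hg, stdSymp_symplecticSharp,
    stdSymp_symplecticSharp, hsymm.eq v w, neg_add_cancel]

end FlatHamiltonianFields

/-! ### The controlled Hamiltonian system in a chart -/

section LocalFields

variable {n m : ℕ} {M : Type*} [TopologicalSpace M] [ChartedSpace (EuclideanSpace ℝ (Fin n)) M]
  [IsManifold (𝓡 n) ∞ M]
  (f₀ : ∀ x : M, TangentSpace (𝓡 n) x) (f : Fin m → ∀ x : M, TangentSpace (𝓡 n) x)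

/-- The coefficients `(1, u₁, …, uₘ)` of the drift and the controlled fields. -/
def coeff (u : Control m) (j : Option (Fin m)) : ℝ := j.elim 1 fun i => u i

theorem abs_coeff_le_one {u : Control m} (hu : ‖u‖ ≤ 1) (j : Option (Fin m)) :
    |coeff u j| ≤ 1 := by
  cases j with
  | none => simp [coeff]
  | some i => exact (PiLp.norm_apply_le u i).trans hu

/-- The functions `h₀, h₁, …, hₘ`. -/
def linHams : Option (Fin m) → CotangentBundle n M → ℝ := fun j => linHam (j.elim f₀ f)

/-- The Hamiltonian fields of `h₀, h₁, …, hₘ` in the canonical coordinates at `c`. -/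
def localFields (c : CotangentBundle n M) (j : Option (Fin m)) : PhaseModel n → PhaseModel n :=
  flatHamVF (localRep c (linHams f₀ f j))

variable {f₀ f}

theorem isOpen_cot_target (c : CotangentBundle n M) :
    IsOpen (extChartAt (cotModel n) c).target :=
  isOpen_extChartAt_target c

theorem contDiffOn_localRep_linHams (hf₀ : IsSmoothVF f₀) (hf : ∀ i, IsSmoothVF (f i))
    (c : CotangentBundle n M) (j : Option (Fin m)) :
    ContDiffOn ℝ ∞ (localRep c (linHams f₀ f j)) (extChartAt (cotModel n) c).target := by
  cases j with
  | none => exact contDiffOn_localRep_linHam hf₀ c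
  | some i => exact contDiffOn_localRep_linHam (hf i) c

theorem contDiffOn_localFields (hf₀ : IsSmoothVF f₀) (hf : ∀ i, IsSmoothVF (f i))
    (c : CotangentBundle n M) (j : Option (Fin m)) :
    ContDiffOn ℝ ∞ (localFields f₀ f c j) (extChartAt (cotModel n) c).target :=
  contDiffOn_flatHamVF (isOpen_cot_target c) (contDiffOn_localRep_linHams hf₀ hf c j)

theorem contDiffAt_localRep_linHams (hf₀ : IsSmoothVF f₀) (hf : ∀ i, IsSmoothVF (f i))
    {c : CotangentBundle n M} {y : PhaseModel n} (hy : y ∈ (extChartAt (cotModel n) c).target)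
    (j : Option (Fin m)) : ContDiffAt ℝ ∞ (localRep c (linHams f₀ f j)) y :=
  (contDiffOn_localRep_linHams hf₀ hf c j).contDiffAt ((isOpen_cot_target c).mem_nhds hy)

theorem combDiff_localFields_skew (hf₀ : IsSmoothVF f₀) (hf : ∀ i, IsSmoothVF (f i))
    {c : CotangentBundle n M} {y : PhaseModel n} (hy : y ∈ (extChartAt (cotModel n) c).target)
    (v : Option (Fin m) → ℝ) (X Y : PhaseModel n) :
    stdSymp (combDiff (localFields f₀ f c) v y X) Y
      + stdSymp X (combDiff (localFields f₀ f c) v y Y) = 0 := by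
  rw [combDiff_apply, combDiff_apply, map_sum, map_sum, sum_apply,
    ← Finset.sum_add_distrib]
  refine Finset.sum_eq_zero fun j _ => ?_
  have := stdSymp_fderiv_flatHamVF_skew (contDiffAt_localRep_linHams hf₀ hf hy j) X Y
  rw [map_smul, map_smul, smul_apply, ← smul_add]
  exact (congrArg (v j • ·) this).trans (smul_zero _)

theorem localRep_pmpHam (c : CotangentBundle n M) (u : Control m) :
    localRep c (pmpHam f₀ f u)
      = fun y => ∑ j, coeff u j * localRep c (linHams f₀ f j) y - ‖u‖ := by
  ext y
  simp [localRep, pmpHam, linHams, coeff, hI, Fintype.sum_option]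

/-- The cost term `-‖u‖` does not depend on the point of `T*M` and disappears, leaving an expression
linear in the coefficients `(1, u)`. -/
theorem hasFDerivAt_localRep_pmpHam (hf₀ : IsSmoothVF f₀) (hf : ∀ i, IsSmoothVF (f i))
    {c : CotangentBundle n M} {y : PhaseModel n} (hy : y ∈ (extChartAt (cotModel n) c).target)
    (u : Control m) : HasFDerivAt (localRep c (pmpHam f₀ f u))
      (∑ j, coeff u j • fderiv ℝ (localRep c (linHams f₀ f j)) y) y := by
  rw [localRep_pmpHam]
  refine HasFDerivAt.sub_const _ (HasFDerivAt.fun_sum fun j _ => ?_)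
  exact (((contDiffAt_localRep_linHams hf₀ hf hy j).differentiableAt
    (by simp)).hasFDerivAt).const_mul _

theorem chartDiff_hamVec_pmpHam (hf₀ : IsSmoothVF f₀) (hf : ∀ i, IsSmoothVF (f i))
    {c ℓ : CotangentBundle n M} (h : ℓ ∈ (extChartAt (cotModel n) c).source) (u : Control m) :
    chartDiff c ℓ (hamVec (pmpHam f₀ f u) ℓ)
      = combField (localFields f₀ f c) (coeff u) (extChartAt (cotModel n) c ℓ) := by
  have hd := hasFDerivAt_localRep_pmpHam hf₀ hf ((extChartAt (cotModel n) c).map_source h) u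
  rw [chartDiff_hamVec h hd.differentiableAt, flatHamVF, hd.fderiv, map_sum]
  simp only [map_smul]
  rfl

/-- Passes from the manifold notion of solution to the integral equation in one chart, where the
estimates apply. Staying in the ball bounds the velocity by `C`, as required by
`eq_add_integral_of_bounded`. -/
theorem IsSolution.isIntegralSolution (hf₀ : IsSmoothVF f₀) (hf : ∀ i, IsSmoothVF (f i))
    {T : ℝ} {u : ℝ → Control m} (hu : ∀ t ∈ Icc 0 T, ‖u t‖ ≤ 1)
    (hui : ∀ j, IntervalIntegrable (fun σ => coeff (u σ) j) volume 0 T)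
    {γ : ℝ → CotangentBundle n M} (hγ : IsSolution (fun t => hamVF (pmpHam f₀ f (u t))) T γ)
    {c : CotangentBundle n M} {y₀ : PhaseModel n} {ρ C : ℝ}
    (hbox : IsFlowBox (localFields f₀ f c) (extChartAt (cotModel n) c).target y₀ ρ C)
    {a b : ℝ} (ha : 0 ≤ a) (hab : a ≤ b) (hb : b ≤ T)
    (hs : ∀ σ ∈ Icc a b, γ σ ∈ (extChartAt (cotModel n) c).source)
    (hball : ∀ σ ∈ Icc a b, extChartAt (cotModel n) c (γ σ) ∈ Metric.closedBall y₀ (2 * ρ)) :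
    IsIntegralSolution (fun σ => combField (localFields f₀ f c) (coeff (u σ))) a b
      (fun σ => extChartAt (cotModel n) c (γ σ)) := by
  have hsub : Icc a b ⊆ Icc 0 T := Icc_subset_Icc ha hb
  have hT : 0 ≤ T := ha.trans (hab.trans hb)
  have hcont : ContinuousOn (fun σ => extChartAt (cotModel n) c (γ σ)) (Icc a b) :=
    (continuousOn_extChartAt c).comp (hγ.continuousOn.mono hsub) hs
  have hint := intervalIntegrable_combField (contDiffOn_localFields hf₀ hf c) hab
    (fun j => (hui j).mono_set (by rwa [uIcc_of_le hab, uIcc_of_le hT])) hcont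
    (fun σ hσ => (extChartAt (cotModel n) c).map_source (hs σ hσ))
  refine ⟨hcont, hint, ?_⟩
  refine (hγ.absolutelyContinuous c a b ha hab hb hs).eq_add_integral_of_bounded hab hint
    (K := C) (fun σ hσ => hbox.norm_le _ (abs_coeff_le_one (hu σ (hsub hσ))) _ (hball σ hσ)) ?_
  filter_upwards [hγ.ae_hasDeriv] with σ hσ hσ'
  have hσm : σ ∈ Icc a b := Ioo_subset_Icc_self hσ'
  have h1 := hσ ⟨lt_of_le_of_lt ha hσ'.1, lt_of_lt_of_le hσ'.2 hb⟩
  have h2 : HasFDerivAt (fun σ => extChartAt (cotModel n) c (γ σ)) (chartDiff c (γ σ) ∘L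
      ContinuousLinearMap.toSpanSingleton ℝ (hamVec (pmpHam f₀ f (u σ)) (γ σ))) σ :=
    ((hasMFDerivAt_extChartAt_cot (hs σ hσm)).comp σ h1).hasFDerivAt
  refine h2.hasDerivAt.congr_deriv ?_
  rw [← chartDiff_hamVec_pmpHam hf₀ hf (hs σ hσm)]
  simp

/-- A solution starting near a solution that stays in a flow box stays in the chart. -/
theorem IsSolution.mem_flowBox [T2Space M] (hf₀ : IsSmoothVF f₀) (hf : ∀ i, IsSmoothVF (f i))
    {T : ℝ} {u : ℝ → Control m} (hu : ∀ t ∈ Icc 0 T, ‖u t‖ ≤ 1)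
    (hui : ∀ j, IntervalIntegrable (fun σ => coeff (u σ) j) volume 0 T)
    {γ lam : ℝ → CotangentBundle n M}
    (hγ : IsSolution (fun t => hamVF (pmpHam f₀ f (u t))) T γ)
    (hlam : IsSolution (fun t => hamVF (pmpHam f₀ f (u t))) T lam)
    {c : CotangentBundle n M} {y₀ : PhaseModel n} {ρ C : ℝ}
    (hbox : IsFlowBox (localFields f₀ f c) (extChartAt (cotModel n) c).target y₀ ρ C)
    {a b : ℝ} (ha : 0 ≤ a) (hb : b ≤ T) (hsmall : C * (b - a) ≤ 1 / 4)
    (hs : ∀ σ ∈ Icc a b, lam σ ∈ (extChartAt (cotModel n) c).source)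
    (hball : ∀ σ ∈ Icc a b, extChartAt (cotModel n) c (lam σ) ∈ Metric.ball y₀ ρ)
    (hγs : γ a ∈ (extChartAt (cotModel n) c).source)
    (hγa : 2 * ‖extChartAt (cotModel n) c (γ a) - extChartAt (cotModel n) c (lam a)‖ < ρ) :
    ∀ σ ∈ Icc a b, γ σ ∈ (extChartAt (cotModel n) c).source ∧
      extChartAt (cotModel n) c (γ σ) ∈ Metric.closedBall y₀ (2 * ρ) := by
  set e := extChartAt (cotModel n) c with he
  let U : Set (CotangentBundle n M) := e.source ∩ e ⁻¹' Metric.ball y₀ (2 * ρ)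
  let W : Set (CotangentBundle n M) := e.symm '' Metric.closedBall y₀ (2 * ρ)
  have hU : IsOpen U := isOpen_extChartAt_preimage' c Metric.isOpen_ball
  -- Compact sets of `T*M` are closed because `T*M` is Hausdorff; otherwise a limit of points of `U`
  -- could lie outside the chart.
  have hW : IsClosed W :=
    ((isCompact_closedBall _ _).image_of_continuousOn
      ((continuousOn_extChartAt_symm c).mono hbox.subset)).isClosed
  have hUW : U ⊆ W := fun ℓ hℓ => ⟨e ℓ, Metric.ball_subset_closedBall hℓ.2, e.left_inv hℓ.1⟩
  have hWs : ∀ ℓ ∈ W, ℓ ∈ e.source ∧ e ℓ ∈ Metric.closedBall y₀ (2 * ρ) := by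
    rintro _ ⟨z, hz, rfl⟩
    exact ⟨e.map_target (hbox.subset hz), by rwa [e.right_inv (hbox.subset hz)]⟩
  suffices h : ∀ σ ∈ Icc a b, γ σ ∈ U from fun σ hσ => hWs _ (hUW (h σ hσ))
  have hρ := hbox.pos
  have hnear : ∀ σ ∈ Icc a b, γ σ ∈ e.source → ‖e (γ σ) - e (lam σ)‖ < ρ → γ σ ∈ U := by
    intro σ hσ h1 h2
    refine ⟨h1, ?_⟩
    have h3 := hball σ hσ
    rw [mem_preimage, Metric.mem_ball] at *
    rw [← dist_eq_norm] at h2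
    linarith [dist_triangle (e (γ σ)) (e (lam σ)) y₀]
  -- First-exit argument. Up to the first time `τ` outside `U` the curve lies in `W`, which is
  -- closed and inside the chart. The estimate is therefore valid on `[a, τ]` and puts `γ τ` back
  -- into `U`.
  by_contra! hne
  have hcont : ContinuousOn γ (Icc a b) := hγ.continuousOn.mono (Icc_subset_Icc ha hb)
  have hcl : IsClosed (Icc a b ∩ γ ⁻¹' Uᶜ) :=
    hcont.preimage_isClosed_of_isClosed isClosed_Icc hU.isClosed_compl
  obtain ⟨τ, ⟨hτ, hτU⟩, hmin⟩ := (isCompact_Icc.of_isClosed_subset hcl inter_subset_left).exists_isLeast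
    hne
  have hbefore : ∀ σ ∈ Ico a τ, γ σ ∈ U := by
    intro σ hσ
    by_contra hσU
    exact absurd (hmin ⟨⟨hσ.1, hσ.2.le.trans hτ.2⟩, hσU⟩) (not_le.mpr hσ.2)
  have haτ : a < τ := by
    refine lt_of_le_of_ne hτ.1 fun h => hτU ?_
    rw [← h]
    refine hnear a ⟨le_rfl, hτ.1.trans hτ.2⟩ hγs ?_
    linarith [norm_nonneg (e (γ a) - e (lam a))]
  have hτW : γ τ ∈ W := by
    have h1 : τ ∈ closure (Ico a τ) := by
      rw [closure_Ico haτ.ne]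
      exact ⟨hτ.1, le_rfl⟩
    have h2 := ((hcont τ hτ).mono fun σ (hσ : σ ∈ Ico a τ) =>
      ⟨hσ.1, hσ.2.le.trans hτ.2⟩).mem_closure h1 (fun σ hσ => hUW (hbefore σ hσ))
    rwa [hW.closure_eq] at h2
  have hin : ∀ σ ∈ Icc a τ, γ σ ∈ W := by
    intro σ hσ
    rcases hσ.2.lt_or_eq with h | h
    · exact hUW (hbefore σ ⟨hσ.1, h⟩)
    · rwa [h]
  have hsub : Icc a τ ⊆ Icc a b := Icc_subset_Icc_right hτ.2
  have hball' : ∀ σ ∈ Icc a b, e (lam σ) ∈ Metric.closedBall y₀ (2 * ρ) := fun σ hσ =>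
    Metric.closedBall_subset_closedBall (by linarith) (Metric.ball_subset_closedBall (hball σ hσ))
  have sγ := hγ.isIntegralSolution hf₀ hf hu hui hbox ha hτ.1 (hτ.2.trans hb)
    (fun σ hσ => (hWs _ (hin σ hσ)).1) (fun σ hσ => (hWs _ (hin σ hσ)).2)
  have sl := hlam.isIntegralSolution hf₀ hf hu hui hbox ha hτ.1 (hτ.2.trans hb)
    (fun σ hσ => hs σ (hsub hσ)) (fun σ hσ => hball' σ (hsub hσ))
  have hbd := sl.norm_sub_le sγ hbox.nonneg
    ((mul_le_mul_of_nonneg_left (by linarith [hτ.2]) hbox.nonneg).trans hsmall)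
    (fun σ hσ => hbox.lipschitz _
      (abs_coeff_le_one (hu σ ⟨ha.trans hσ.1, (hσ.2.trans hτ.2).trans hb⟩)) _
      (hWs _ (hin σ hσ)).2 _ (hball' σ (hsub hσ))) τ ⟨hτ.1, le_rfl⟩
  exact hτU (hnear τ hτ (hWs _ hτW).1 (lt_of_le_of_lt hbd hγa))

end LocalFields

/-- A chain rule in which `h` need not be a function of `g`: it is enough that increments of `h` are
`R` applied to increments of `g`, up to little-o of the latter. -/
theorem hasFDerivAt_of_eventually_norm_sub_le {E F : Type*} [NormedAddCommGroup E]
    [NormedSpace ℝ E] [NormedAddCommGroup F] [NormedSpace ℝ F] {g h : E → F} {x : E}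
    {B : E →L[ℝ] F} {R : F →L[ℝ] F} (hg : HasFDerivAt g B x)
    (hh : ∀ ε > 0, ∀ᶠ z in 𝓝 x, ‖h z - h x - R (g z - g x)‖ ≤ ε * ‖g z - g x‖) :
    HasFDerivAt h (R ∘L B) x := by
  have h1 : (fun z => h z - h x - R (g z - g x)) =o[𝓝 x] fun z => g z - g x :=
    Asymptotics.isLittleO_iff.mpr fun ε hε => hh ε hε
  have h2 := h1.trans_isBigO hg.isBigO_sub
  have h3 := (R.hasFDerivAt.comp x hg).isLittleO
  refine HasFDerivAt.of_isLittleO ((h2.add h3).congr_left fun z => ?_)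
  simp only [Function.comp_apply, map_sub]
  abel

/-! ### Differentiability and symplecticity of the flow -/

section FlowRegularity

variable {n m : ℕ} {M : Type*} [TopologicalSpace M] [ChartedSpace (EuclideanSpace ℝ (Fin n)) M]
  [IsManifold (𝓡 n) ∞ M]
  {f₀ : ∀ x : M, TangentSpace (𝓡 n) x} {f : Fin m → ∀ x : M, TangentSpace (𝓡 n) x}

/-- The differential at `ℓ` of `Φ t`. -/
def flowDiff (Φ : ℝ → CotangentBundle n M → CotangentBundle n M) (ℓ : CotangentBundle n M)
    (t : ℝ) : PhaseModel n →L[ℝ] PhaseModel n :=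
  mfderiv (cotModel n) (cotModel n) (Φ t) ℓ

/-- `Φ t` is differentiable at `lam 0`, with symplectic differential, and maps it to `lam t`. -/
structure IsFlowRegular (Φ : ℝ → CotangentBundle n M → CotangentBundle n M)
    (lam : ℝ → CotangentBundle n M) (t : ℝ) : Prop where
  eq : Φ t (lam 0) = lam t
  mdifferentiableAt : MDifferentiableAt (cotModel n) (cotModel n) (Φ t) (lam 0)
  symplectic : ∀ X Y, stdSymp (flowDiff Φ (lam 0) t X) (flowDiff Φ (lam 0) t Y) = stdSymp X Y

theorem IsFlowRegular.hasMFDerivAt_chart {Φ : ℝ → CotangentBundle n M → CotangentBundle n M}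
    {lam : ℝ → CotangentBundle n M} {t : ℝ} {c : CotangentBundle n M} (heq : Φ t (lam 0) = lam t)
    (hd : MDifferentiableAt (cotModel n) (cotModel n) (Φ t) (lam 0))
    (hs : lam t ∈ (extChartAt (cotModel n) c).source) :
    HasMFDerivAt (cotModel n) 𝓘(ℝ, PhaseModel n) (fun ℓ => extChartAt (cotModel n) c (Φ t ℓ))
      (lam 0) (chartDiff c (lam t) ∘L flowDiff Φ (lam 0) t) := by
  have h := (hasMFDerivAt_extChartAt_cot (c := c) (ℓ := Φ t (lam 0)) (by rwa [heq])).comp (lam 0)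
    hd.hasMFDerivAt
  have h' : HasMFDerivAt (cotModel n) 𝓘(ℝ, PhaseModel n)
      (fun ℓ => extChartAt (cotModel n) c (Φ t ℓ)) (lam 0)
      (chartDiff c (Φ t (lam 0)) ∘L flowDiff Φ (lam 0) t) := h
  rwa [heq] at h'

/-- Along `[a, b]`, the curve `lam` stays in a flow box of the canonical coordinates at `c`. -/
structure IsTimeBox (f₀ : ∀ x : M, TangentSpace (𝓡 n) x) (f : Fin m → ∀ x : M, TangentSpace (𝓡 n) x)
    (lam : ℝ → CotangentBundle n M) (c : CotangentBundle n M) (ρ C a b : ℝ) : Prop where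
  box : IsFlowBox (localFields f₀ f c) (extChartAt (cotModel n) c).target
    (extChartAt (cotModel n) c c) ρ C
  small : C * (b - a) ≤ 1 / 4
  mem_source : ∀ σ ∈ Icc a b, lam σ ∈ (extChartAt (cotModel n) c).source
  mem_ball : ∀ σ ∈ Icc a b,
    extChartAt (cotModel n) c (lam σ) ∈ Metric.ball (extChartAt (cotModel n) c c) ρ

theorem IsTimeBox.mem_closedBall {lam : ℝ → CotangentBundle n M} {c : CotangentBundle n M}
    {ρ C a b : ℝ} (h : IsTimeBox f₀ f lam c ρ C a b) : ∀ σ ∈ Icc a b,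
    extChartAt (cotModel n) c (lam σ) ∈
      Metric.closedBall (extChartAt (cotModel n) c c) (2 * ρ) := fun σ hσ =>
  Metric.closedBall_subset_closedBall (by linarith [h.box.pos])
    (Metric.ball_subset_closedBall (h.mem_ball σ hσ))

theorem exists_isTimeBox (hf₀ : IsSmoothVF f₀) (hf : ∀ i, IsSmoothVF (f i))
    {T : ℝ} {lam : ℝ → CotangentBundle n M} (hlam : ContinuousOn lam (Icc 0 T))
    {t : ℝ} (ht : t ∈ Icc 0 T) :
    ∃ ρ C η, 0 < η ∧ ∀ a b, 0 ≤ a → b ≤ T → t - η ≤ a → b ≤ t + η →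
      IsTimeBox f₀ f lam (lam t) ρ C a b := by
  obtain ⟨ρ, C, hbox⟩ := exists_isFlowBox (isOpen_cot_target (lam t))
    (contDiffOn_localFields hf₀ hf (lam t)) (mem_extChartAt_target (I := cotModel n) (lam t))
  have hev : ∀ᶠ σ in 𝓝[Icc 0 T] t, lam σ ∈ (extChartAt (cotModel n) (lam t)).source ∩
      extChartAt (cotModel n) (lam t) ⁻¹'
        Metric.ball (extChartAt (cotModel n) (lam t) (lam t)) ρ :=
    (hlam t ht).eventually_mem ((isOpen_extChartAt_preimage' _ Metric.isOpen_ball).mem_nhds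
      ⟨mem_extChartAt_source _, Metric.mem_ball_self hbox.pos⟩)
  obtain ⟨δ, hδ, hsub⟩ := Metric.mem_nhdsWithin_iff.mp hev
  have hC := hbox.nonneg
  -- The bound `δ / 2` keeps the window inside the `δ`-ball. The other bound makes its length at
  -- most `1 / (4 (C + 1))`, whence `C (b - a) ≤ 1 / 4`, also when `C = 0`.
  refine ⟨ρ, C, min (δ / 2) (1 / (8 * (C + 1))), by positivity, fun a b ha hb hta htb => ?_⟩
  have hmem : ∀ σ ∈ Icc a b, σ ∈ Metric.ball t δ ∩ Icc 0 T := by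
    intro σ hσ
    refine ⟨?_, ha.trans hσ.1, hσ.2.trans hb⟩
    rw [Metric.mem_ball, Real.dist_eq, abs_lt]
    have := min_le_left (δ / 2) (1 / (8 * (C + 1)))
    constructor <;> linarith [hσ.1, hσ.2]
  refine ⟨hbox, ?_, fun σ hσ => (hsub (hmem σ hσ)).1, fun σ hσ => (hsub (hmem σ hσ)).2⟩
  have h1 : b - a ≤ 2 * (1 / (8 * (C + 1))) := by
    linarith [min_le_right (δ / 2) (1 / (8 * (C + 1)))]
  calc C * (b - a) ≤ C * (2 * (1 / (8 * (C + 1)))) := mul_le_mul_of_nonneg_left h1 hC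
    _ = C / (C + 1) * (1 / 4) := by field_simp; ring
    _ ≤ 1 * (1 / 4) := by
      gcongr
      rw [div_le_one (by positivity)]
      linarith
    _ = 1 / 4 := one_mul _

/-- The coefficient of the equation linearized along `lam`, in the coordinates at `c`. -/
def linearization (f₀ : ∀ x : M, TangentSpace (𝓡 n) x) (f : Fin m → ∀ x : M, TangentSpace (𝓡 n) x)
    (u : ℝ → Control m) (lam : ℝ → CotangentBundle n M) (c : CotangentBundle n M) (σ : ℝ) :
    PhaseModel n →L[ℝ] PhaseModel n :=
  combDiff (localFields f₀ f c) (coeff (u σ)) (extChartAt (cotModel n) c (lam σ))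

/-- Regularity at `a` passes to all of `[a, b]`. Solutions from points near `λ₀` stay in the box,
and to first order their deviation from `lam` at time `τ` is `R τ` applied to the deviation at `a`.
So the differential of the flow gets composed with `R τ`, which preserves `σ`. The resolvent is part
of the conclusion because the time derivative of the differential is needed later. -/
theorem IsFlowRegular.propagate [T2Space M] (hf₀ : IsSmoothVF f₀) (hf : ∀ i, IsSmoothVF (f i))
    {T : ℝ} {u : ℝ → Control m} (hu : ∀ t ∈ Icc 0 T, ‖u t‖ ≤ 1)
    (hui : ∀ j, IntervalIntegrable (fun σ => coeff (u σ) j) volume 0 T)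
    {lam : ℝ → CotangentBundle n M} {Φ : ℝ → CotangentBundle n M → CotangentBundle n M}
    (hlam : IsSolution (fun t => hamVF (pmpHam f₀ f (u t))) T lam)
    (hΦ : IsFlowNear f₀ f T u (lam 0) Φ) {c : CotangentBundle n M} {ρ C a b : ℝ}
    (hbox : IsTimeBox f₀ f lam c ρ C a b) (ha : 0 ≤ a) (hab : a ≤ b) (hb : b ≤ T)
    (hreg : IsFlowRegular Φ lam a) :
    ∃ R, IsResolvent (linearization f₀ f u lam c) a b R ∧ ∀ τ ∈ Icc a b,
      IsFlowRegular Φ lam τ ∧ chartDiff c (lam τ) ∘L flowDiff Φ (lam 0) τ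
        = R τ ∘L (chartDiff c (lam a) ∘L flowDiff Φ (lam 0) a) := by
  set e := extChartAt (cotModel n) c with he
  have hsub : Icc a b ⊆ Icc 0 T := Icc_subset_Icc ha hb
  have hT : 0 ≤ T := ha.trans (hab.trans hb)
  have haI : a ∈ Icc a b := ⟨le_rfl, hab⟩
  have sl := hlam.isIntegralSolution hf₀ hf hu hui hbox.box ha hab hb hbox.mem_source
    hbox.mem_closedBall
  have hA := intervalIntegrable_combDiff (E := PhaseModel n) (isOpen_cot_target c)
      (contDiffOn_localFields hf₀ hf c) hab
      (fun j => (hui j).mono_set (by rwa [uIcc_of_le hab, uIcc_of_le hT])) sl.continuousOn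
      (fun σ hσ => e.map_source (hbox.mem_source σ hσ))
  have hAC : ∀ σ ∈ Icc a b, ‖linearization f₀ f u lam c σ‖ ≤ C := fun σ hσ =>
    hbox.box.norm_diff_le _ (abs_coeff_le_one (hu σ (hsub hσ))) _ (hbox.mem_closedBall σ hσ)
  obtain ⟨R, hR⟩ := exists_isResolvent hab hA hAC hbox.small
  refine ⟨R, hR, ?_⟩
  have hRsymp := hR.preserves_form hab hA hAC stdSymp fun σ hσ v w =>
    combDiff_localFields_skew hf₀ hf (e.map_source (hbox.mem_source σ hσ)) _ v w
  have hmfd := IsFlowRegular.hasMFDerivAt_chart hreg.eq hreg.mdifferentiableAt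
    (hbox.mem_source a haI)
  have hca : ContinuousAt (fun ℓ => e (Φ a ℓ)) (lam 0) := hmfd.continuousAt
  have hρ := hbox.box.pos
  -- solutions starting near `lam 0`
  have hclose : ∀ δ > 0, ∀ᶠ ℓ in 𝓝 (lam 0), 2 * ‖e (Φ a ℓ) - e (lam a)‖ < δ := by
    intro δ hδ
    filter_upwards [hca.eventually (Metric.ball_mem_nhds _ (half_pos hδ))] with ℓ hℓ
    rw [hreg.eq] at hℓ
    change dist _ _ < _ at hℓ
    rw [dist_eq_norm] at hℓ
    linarith
  have hgood : ∀ᶠ ℓ in 𝓝 (lam 0), (∀ σ ∈ Icc a b, Φ σ ℓ ∈ e.source ∧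
      e (Φ σ ℓ) ∈ Metric.closedBall (e c) (2 * ρ)) ∧
      IsIntegralSolution (fun σ => combField (localFields f₀ f c) (coeff (u σ))) a b
        (fun σ => e (Φ σ ℓ)) := by
    have h1 : ∀ᶠ ℓ in 𝓝 (lam 0), Φ a ℓ ∈ e.source :=
      hreg.mdifferentiableAt.continuousAt.eventually_mem
        (by rw [hreg.eq]; exact extChartAt_source_mem_nhds' (hbox.mem_source a haI))
    filter_upwards [hΦ, h1, hclose ρ hρ] with ℓ hℓ hℓs hℓρ
    have h2 := hℓ.2.mem_flowBox hf₀ hf hu hui hlam hbox.box ha hb hbox.small hbox.mem_source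
      hbox.mem_ball hℓs hℓρ
    exact ⟨h2, hℓ.2.isIntegralSolution hf₀ hf hu hui hbox.box ha hab hb (fun σ hσ => (h2 σ hσ).1)
      (fun σ hσ => (h2 σ hσ).2)⟩
  have hlip : ∀ {ℓ}, (∀ σ ∈ Icc a b, Φ σ ℓ ∈ e.source ∧
      e (Φ σ ℓ) ∈ Metric.closedBall (e c) (2 * ρ)) → ∀ σ ∈ Icc a b,
      ‖combField (localFields f₀ f c) (coeff (u σ)) (e (Φ σ ℓ)) -
        combField (localFields f₀ f c) (coeff (u σ)) (e (lam σ))‖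
        ≤ C * ‖e (Φ σ ℓ) - e (lam σ)‖ := fun h σ hσ =>
    hbox.box.lipschitz _ (abs_coeff_le_one (hu σ (hsub hσ))) _ (h σ hσ).2 _
      (hbox.mem_closedBall σ hσ)
  have hbd : ∀ᶠ ℓ in 𝓝 (lam 0), ∀ τ ∈ Icc a b,
      ‖e (Φ τ ℓ) - e (lam τ)‖ ≤ 2 * ‖e (Φ a ℓ) - e (lam a)‖ := by
    filter_upwards [hgood] with ℓ hℓ
    exact sl.norm_sub_le hℓ.2 hbox.box.nonneg hbox.small (hlip hℓ.1)
  have hlin : ∀ ε > 0, ∀ᶠ ℓ in 𝓝 (lam 0), ∀ τ ∈ Icc a b,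
      ‖e (Φ τ ℓ) - e (lam τ) - R τ (e (Φ a ℓ) - e (lam a))‖
        ≤ 4 * ε * (b - a) * ‖e (Φ a ℓ) - e (lam a)‖ := by
    intro ε hε
    obtain ⟨δ, hδ, hdiff⟩ := hbox.box.differentiable ε hε
    filter_upwards [hgood, hbd, hclose δ hδ] with ℓ hℓ hℓb hℓδ
    exact sl.norm_sub_resolvent_le hR hA hAC hℓ.2 hbox.box.nonneg hε.le hbox.small (hlip hℓ.1)
      fun σ hσ => hdiff _ (abs_coeff_le_one (hu σ (hsub hσ))) _ (hℓ.1 σ hσ).2 _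
        (hbox.mem_closedBall σ hσ) ((hℓb σ hσ).trans hℓδ.le)
  intro τ hτ
  -- Uniqueness: at `ℓ = lam 0` the initial deviation vanishes, so the estimate `hbd` forces the two
  -- solutions to agree.
  have heτ : Φ τ (lam 0) = lam τ := by
    refine e.injOn (hgood.self_of_nhds.1 τ hτ).1 (hbox.mem_source τ hτ) ?_
    have := hbd.self_of_nhds τ hτ
    rw [hreg.eq, sub_self, norm_zero, mul_zero] at this
    exact sub_eq_zero.mp (norm_le_zero_iff.mp this)
  have hmτ : HasMFDerivAt (cotModel n) 𝓘(ℝ, PhaseModel n) (fun ℓ => e (Φ τ ℓ)) (lam 0)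
      (R τ ∘L (chartDiff c (lam a) ∘L flowDiff Φ (lam 0) a)) := by
    refine hasMFDerivAt_cot_iff.mpr ⟨?_, ?_⟩
    · rw [ContinuousAt, heτ, tendsto_iff_norm_sub_tendsto_zero]
      have h0 : Tendsto (fun ℓ => 2 * ‖e (Φ a ℓ) - e (lam a)‖) (𝓝 (lam 0)) (𝓝 0) := by
        have := (tendsto_iff_norm_sub_tendsto_zero.mp hca).const_mul 2
        simpa only [hreg.eq, mul_zero] using this
      exact squeeze_zero' (Eventually.of_forall fun _ => norm_nonneg _)
        (hbd.mono fun ℓ hℓ => hℓ τ hτ) h0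
    · refine hasFDerivAt_of_eventually_norm_sub_le (hasMFDerivAt_cot_iff.mp hmfd).2 fun ε hε => ?_
      have hba : 0 ≤ b - a := sub_nonneg.mpr hab
      have hsymm : Tendsto (extChartAt (cotModel n) (lam 0)).symm
          (𝓝 (extChartAt (cotModel n) (lam 0) (lam 0))) (𝓝 (lam 0)) := by
        have := continuousAt_extChartAt_symm (I := cotModel n) (lam 0)
        rwa [ContinuousAt, extChartAt_to_inv] at this
      -- This choice compensates the factor `4 (b - a)` in `hlin`; the `+ 1` covers `a = b`.
      filter_upwards [hsymm.eventually (hlin (ε / (4 * (b - a + 1))) (by positivity))] with x hx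
      simp only [Function.comp_apply, extChartAt_to_inv, heτ, hreg.eq]
      refine (hx τ hτ).trans (mul_le_mul_of_nonneg_right ?_ (norm_nonneg _))
      rw [show 4 * (ε / (4 * (b - a + 1))) * (b - a) = ε * ((b - a) / (b - a + 1)) by
        field_simp]
      exact mul_le_of_le_one_right hε.le ((div_le_one (by positivity)).mpr (by linarith))
  have hdτ : MDifferentiableAt (cotModel n) (cotModel n) (Φ τ) (lam 0) := by
    have ht : e (Φ τ (lam 0)) ∈ e.target := by
      rw [heτ]; exact e.map_source (hbox.mem_source τ hτ)
    have h1 : MDifferentiableAt 𝓘(ℝ, PhaseModel n) (cotModel n) e.symm (e (Φ τ (lam 0))) :=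
      ((contMDiffOn_extChartAt_symm (n := ∞) c).contMDiffAt
        ((isOpen_cot_target c).mem_nhds ht)).mdifferentiableAt (by simp)
    refine (h1.comp (lam 0) hmτ.mdifferentiableAt).congr_of_eventuallyEq ?_
    filter_upwards [hgood] with ℓ hℓ
    exact (e.left_inv (hℓ.1 τ hτ).1).symm
  have heq : chartDiff c (lam τ) ∘L flowDiff Φ (lam 0) τ
      = R τ ∘L (chartDiff c (lam a) ∘L flowDiff Φ (lam 0) a) :=
    (hasMFDerivAt_cot_iff.mp (IsFlowRegular.hasMFDerivAt_chart heτ hdτ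
      (hbox.mem_source τ hτ))).2.unique (hasMFDerivAt_cot_iff.mp hmτ).2
  refine ⟨⟨heτ, hdτ, fun X Y => ?_⟩, heq⟩
  have hX : ∀ Z, chartDiff c (lam τ) (flowDiff Φ (lam 0) τ Z)
      = R τ (chartDiff c (lam a) (flowDiff Φ (lam 0) a Z)) := fun Z => congrArg (fun L => L Z) heq
  rw [← stdSymp_chartDiff (hbox.mem_source τ hτ), hX, hX, hRsymp τ hτ,
    stdSymp_chartDiff (hbox.mem_source a haI), hreg.symplectic]

theorem isFlowRegular_zero {T : ℝ} {u : ℝ → Control m}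
    {lam : ℝ → CotangentBundle n M} {Φ : ℝ → CotangentBundle n M → CotangentBundle n M}
    (hΦ : IsFlowNear f₀ f T u (lam 0) Φ) : IsFlowRegular Φ lam 0 := by
  have h0 : HasMFDerivAt (cotModel n) (cotModel n) (Φ 0) (lam 0)
      (ContinuousLinearMap.id ℝ (TangentSpace (cotModel n) (lam 0))) :=
    (hasMFDerivAt_id (lam 0)).congr_of_eventuallyEq (hΦ.mono fun ℓ hℓ => hℓ.1)
  refine ⟨hΦ.self_of_nhds.1, h0.mdifferentiableAt, fun X Y => ?_⟩
  have h1 : flowDiff Φ (lam 0) 0 = ContinuousLinearMap.id ℝ (PhaseModel n) := h0.mfderiv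
  rw [h1]
  rfl

/-- The flow is differentiable, with symplectic differential, at all times. -/
theorem isFlowRegular [T2Space M] (hf₀ : IsSmoothVF f₀) (hf : ∀ i, IsSmoothVF (f i))
    {T : ℝ} (hT : 0 ≤ T) {u : ℝ → Control m} (hu : ∀ t ∈ Icc 0 T, ‖u t‖ ≤ 1)
    (hui : ∀ j, IntervalIntegrable (fun σ => coeff (u σ) j) volume 0 T)
    {lam : ℝ → CotangentBundle n M} {Φ : ℝ → CotangentBundle n M → CotangentBundle n M}
    (hlam : IsSolution (fun t => hamVF (pmpHam f₀ f (u t))) T lam)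
    (hΦ : IsFlowNear f₀ f T u (lam 0) Φ) : ∀ t ∈ Icc 0 T, IsFlowRegular Φ lam t := by
  choose ρ C η hη hbox using fun t : Icc 0 T => exists_isTimeBox hf₀ hf hlam.continuousOn t.2
  -- A finite subdivision of `[0, T]` each piece of which fits in one time window; regularity then
  -- propagates from piece to piece, starting from `Φ 0 = id` near `λ₀`.
  obtain ⟨s, hs0, hsm, ⟨N, hN⟩, hs⟩ := exists_monotone_Icc_subset_open_cover_Icc hT
    (c := fun t : Icc 0 T => Metric.ball t (η t)) (fun t => Metric.isOpen_ball)
    (fun t _ => mem_iUnion.mpr ⟨t, Metric.mem_ball_self (hη t)⟩)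
  have hind : ∀ k : ℕ, ∀ t ∈ Icc 0 (s k : ℝ), IsFlowRegular Φ lam t := by
    intro k
    induction k with
    | zero =>
      intro t ht
      rw [hs0] at ht
      rw [le_antisymm ht.2 ht.1]
      exact isFlowRegular_zero hΦ
    | succ k ih =>
      intro t ht
      rcases le_total t (s k) with h | h
      · exact ih t ⟨ht.1, h⟩
      · obtain ⟨i, hi⟩ := hs k
        have hk : (s k : ℝ) ≤ s (k + 1) := hsm (Nat.le_succ k)
        have h1 := hi (left_mem_Icc.mpr (hsm (Nat.le_succ k)))
        have h2 := hi (right_mem_Icc.mpr (hsm (Nat.le_succ k)))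
        rw [Metric.mem_ball, Subtype.dist_eq, Real.dist_eq, abs_lt] at h1 h2
        obtain ⟨R, -, hR⟩ := (ih (s k) ⟨(s k).2.1, le_rfl⟩).propagate hf₀ hf hu hui hlam hΦ
          (hbox i (s k) (s (k + 1)) (s k).2.1 (s (k + 1)).2.2 (by linarith) (by linarith))
          (s k).2.1 hk (s (k + 1)).2.2
        exact (hR t ⟨h, ht.2⟩).1
  exact fun t ht => hind N t ⟨ht.1, by rw [hN N le_rfl]; exact ht.2⟩

end FlowRegularity

/-- The quotient rule for `P⁻¹ x`. -/
theorem hasDerivWithinAt_inverse_apply {E : Type*} [NormedAddCommGroup E] [NormedSpace ℝ E]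
    [CompleteSpace E] {P : ℝ → E →L[ℝ] E} {P' : E →L[ℝ] E} {x : ℝ → E} {x' : E} {s : Set ℝ} {t : ℝ}
    (hP : HasDerivWithinAt P P' s t) (hinv : (P t).IsInvertible) (hx : HasDerivWithinAt x x' s t) :
    HasDerivWithinAt (fun τ => (P τ).inverse (x τ))
      ((P t).inverse (x' - P' ((P t).inverse (x t)))) s t := by
  obtain ⟨e, he⟩ := hinv
  let U : (E →L[ℝ] E)ˣ := ContinuousLinearEquiv.unitsEquiv ℝ E |>.symm e
  have hU : (U : E →L[ℝ] E) = P t := he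
  have h1 := hasFDerivAt_ringInverse (𝕜 := ℝ) U
  rw [hU] at h1
  have h2 := (h1.comp_hasDerivWithinAt t hP).clm_apply hx
  have h3 : (↑U⁻¹ : E →L[ℝ] E) = (P t).inverse := by
    rw [← ContinuousLinearMap.ringInverse_eq_inverse, ← hU, Ring.inverse_unit]
  rw [h3] at h2
  simp only [Function.comp_def, ContinuousLinearMap.ringInverse_eq_inverse] at h2
  refine h2.congr_deriv ?_
  simp [sub_eq_add_neg, add_comm]

theorem differentiableAt_clm_comp {E F G : Type*} [NormedAddCommGroup E] [NormedSpace ℝ E]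
    [NormedAddCommGroup F] [NormedSpace ℝ F] [NormedAddCommGroup G] [NormedSpace ℝ G]
    (L : F →L[ℝ] G) {g : E → F} {z : E} (hd : DifferentiableAt ℝ g z) :
    DifferentiableAt ℝ (fun y => L (g y)) z :=
  (L.hasFDerivAt.comp z hd.hasFDerivAt).differentiableAt

/-! ### Poisson bracket identities -/

section FlatIdentities

variable {V : Type*} [NormedAddCommGroup V] [NormedSpace ℝ V] [FiniteDimensional ℝ V]
  {Ω : Set (V × (V →L[ℝ] ℝ))} {y : V × (V →L[ℝ] ℝ)} {g k : V × (V →L[ℝ] ℝ) → ℝ}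

theorem flatPoisson_eq_stdSymp (a b : V × (V →L[ℝ] ℝ) → ℝ) (y : V × (V →L[ℝ] ℝ)) :
    flatPoisson a b y = stdSymp (flatHamVF a y) (flatHamVF b y) :=
  (stdSymp_flatHamVF b y _).symm

theorem differentiableAt_flatHamVF (hg : ContDiffAt ℝ ∞ g y) :
    DifferentiableAt ℝ (flatHamVF g) y := by
  have hd : DifferentiableAt ℝ (fderiv ℝ g) y :=
    (hg.fderiv_right (m := ∞) (by norm_cast)).differentiableAt (by simp)
  exact differentiableAt_clm_comp (E := V × (V →L[ℝ] ℝ)) (F := (V × (V →L[ℝ] ℝ)) →L[ℝ] ℝ)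
    (symplecticSharp (V := V)) hd

theorem hasFDerivAt_flatPoisson (hg : ContDiffAt ℝ ∞ g y) (hk : ContDiffAt ℝ ∞ k y) :
    HasFDerivAt (flatPoisson g k)
      (stdSymp (flatHamVF g y) ∘L fderiv ℝ (flatHamVF k) y
        + (stdSymp.flip (flatHamVF k y)) ∘L fderiv ℝ (flatHamVF g) y) y := by
  have h1 := (differentiableAt_flatHamVF hg).hasFDerivAt
  have h2 := (differentiableAt_flatHamVF hk).hasFDerivAt
  have h := (stdSymp (V := V)).hasFDerivAt_of_bilinear h1 h2
  have he : flatPoisson g k = fun z => stdSymp (flatHamVF g z) (flatHamVF k z) :=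
    funext fun z => flatPoisson_eq_stdSymp g k z
  rw [he]
  refine h.congr_fderiv ?_
  ext v <;> simp

/-- Differentiating the bracket `{g, k}` along the Hamiltonian field of `k`. -/
theorem flatPoisson_flatPoisson (hg : ContDiffAt ℝ ∞ g y) (hk : ContDiffAt ℝ ∞ k y) :
    flatPoisson k (flatPoisson g k) y = stdSymp (flatHamVF k y)
      (fderiv ℝ (flatHamVF k) y (flatHamVF g y) - fderiv ℝ (flatHamVF g) y (flatHamVF k y)) := by
  -- Skewness of `DX_k` moves it onto `X_g`; the two terms of the product rule then combine into the
  -- Lie bracket `[X_g, X_k]`.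
  have h1 := stdSymp_fderiv_flatHamVF_skew hk (flatHamVF g y) (flatHamVF k y)
  have h2 := stdSymp_antisymm (fderiv ℝ (flatHamVF k) y (flatHamVF g y)) (flatHamVF k y)
  have h3 := stdSymp_antisymm (fderiv ℝ (flatHamVF g) y (flatHamVF k y)) (flatHamVF k y)
  rw [flatPoisson, (hasFDerivAt_flatPoisson hg hk).fderiv, map_sub]
  change stdSymp (flatHamVF g y) (fderiv ℝ (flatHamVF k) y (flatHamVF k y))
    + stdSymp (fderiv ℝ (flatHamVF g) y (flatHamVF k y)) (flatHamVF k y) = _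
  linarith

variable {ι : Type*} [Fintype ι] {h : ι → V × (V →L[ℝ] ℝ) → ℝ}

/-- Half the sum of the squares of the functions `h i`. -/
def halfSumSq (h : ι → V × (V →L[ℝ] ℝ) → ℝ) (z : V × (V →L[ℝ] ℝ)) : ℝ := (∑ i, h i z ^ 2) / 2

theorem contDiffAt_halfSumSq (hh : ∀ i, ContDiffAt ℝ ∞ (h i) y) :
    ContDiffAt ℝ ∞ (halfSumSq h) y :=
  (ContDiffAt.sum fun i _ => (hh i).pow 2).div_const 2

theorem flatHamVF_halfSumSq (hh : ∀ i, DifferentiableAt ℝ (h i) y) :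
    flatHamVF (halfSumSq h) y = ∑ i, h i y • flatHamVF (h i) y := by
  have h1 : HasFDerivAt (halfSumSq h) (∑ i, h i y • fderiv ℝ (h i) y) y := by
    have h2 := (HasFDerivAt.fun_sum (u := Finset.univ) fun i _ =>
      (hh i).hasFDerivAt.pow 2).mul_const (2⁻¹ : ℝ)
    have h3 : halfSumSq h = fun z => (∑ i, h i z ^ 2) * 2⁻¹ := by
      ext z; rw [halfSumSq, div_eq_mul_inv]
    rw [h3]
    refine h2.congr_fderiv ?_
    rw [Finset.smul_sum]
    refine Finset.sum_congr rfl fun i _ => ?_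
    rw [smul_smul]
    congr 1
    simp
  rw [flatHamVF, h1.fderiv, map_sum]
  simp only [map_smul]
  rfl

/-- The bracket of a quadratic Hamiltonian with itself vanishes; this is its derivative. -/
theorem sum_mul_flatPoisson_halfSumSq (hΩ : IsOpen Ω) (hy : y ∈ Ω)
    (hh : ∀ i, ContDiffOn ℝ ∞ (h i) Ω) :
    (∑ i, h i y * stdSymp (flatHamVF (h i) y) (flatHamVF (halfSumSq h) y) = 0) ∧
    ∑ i, h i y * flatPoisson (halfSumSq h) (flatPoisson (h i) (halfSumSq h)) y
      = ∑ i, stdSymp (flatHamVF (h i) y) (flatHamVF (halfSumSq h) y) ^ 2 := by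
  have hat : ∀ z ∈ Ω, ∀ i, ContDiffAt ℝ ∞ (h i) z := fun z hz i =>
    (hh i).contDiffAt (hΩ.mem_nhds hz)
  have hd : ∀ z ∈ Ω, ∀ i, DifferentiableAt ℝ (h i) z := fun z hz i =>
    (hat z hz i).differentiableAt (by simp)
  have hzero : ∀ z ∈ Ω, ∑ i, h i z * flatPoisson (h i) (halfSumSq h) z = 0 := by
    intro z hz
    have h1 : stdSymp (flatHamVF (halfSumSq h) z) (flatHamVF (halfSumSq h) z) = 0 := by
      have := stdSymp_antisymm (flatHamVF (halfSumSq h) z) (flatHamVF (halfSumSq h) z)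
      linarith
    have h2 : stdSymp (∑ i, h i z • flatHamVF (h i) z) (flatHamVF (halfSumSq h) z) = 0 := by
      rwa [← flatHamVF_halfSumSq (hd z hz)]
    rw [map_sum, sum_apply] at h2
    rw [← h2]
    refine Finset.sum_congr rfl fun i _ => ?_
    rw [flatPoisson_eq_stdSymp, map_smul, smul_apply, smul_eq_mul]
  have hsum := HasFDerivAt.fun_sum (u := Finset.univ) fun i _ => (hd y hy i).hasFDerivAt.mul
    (hasFDerivAt_flatPoisson (hat y hy i) (contDiffAt_halfSumSq (hat y hy)))
  have h0 : HasFDerivAt (fun z => ∑ i, h i z * flatPoisson (h i) (halfSumSq h) z)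
      (0 : (V × (V →L[ℝ] ℝ)) →L[ℝ] ℝ) y :=
    (hasFDerivAt_const (0 : ℝ) y).congr_of_eventuallyEq
      (Filter.eventuallyEq_of_mem (hΩ.mem_nhds hy) hzero)
  -- With `h_c` the half sum of squares, the identity `Σ hᵢ {hᵢ, h_c} = 0` differentiated along
  -- `h⃗_c` gives `Σ hᵢ {h_c, {hᵢ, h_c}} + Σ {hᵢ, h_c} {h_c, hᵢ} = 0`.
  have h1 := congrArg (fun L => L (flatHamVF (halfSumSq h) y)) (hsum.unique h0)
  simp only [sum_apply, add_apply, smul_apply, zero_apply, Finset.sum_add_distrib] at h1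
  refine ⟨by simpa only [flatPoisson_eq_stdSymp] using hzero y hy, ?_⟩
  have h2 : ∀ i, flatPoisson (halfSumSq h) (flatPoisson (h i) (halfSumSq h)) y
      = (stdSymp (flatHamVF (h i) y) ∘L fderiv ℝ (flatHamVF (halfSumSq h)) y
        + (stdSymp.flip (flatHamVF (halfSumSq h) y)) ∘L fderiv ℝ (flatHamVF (h i)) y)
          (flatHamVF (halfSumSq h) y) := fun i => by
    rw [flatPoisson,
      (hasFDerivAt_flatPoisson (hat y hy i) (contDiffAt_halfSumSq (hat y hy))).fderiv]
  have h3 : ∀ i, fderiv ℝ (h i) y (flatHamVF (halfSumSq h) y)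
      = - stdSymp (flatHamVF (h i) y) (flatHamVF (halfSumSq h) y) := fun i => by
    rw [← stdSymp_flatHamVF, stdSymp_antisymm]
  simp only [h2, add_apply]
  simp only [smul_eq_mul, h3, flatPoisson_eq_stdSymp] at h1
  have h4 : ∀ a : ℝ, a * -a = -(a ^ 2) := fun a => by ring
  simp only [h4, Finset.sum_neg_distrib] at h1
  linarith

end FlatIdentities

/-! ### Symplectic linear maps, and `Z_t` in canonical coordinates -/

section SymplecticMaps

variable {V : Type*} [NormedAddCommGroup V] [NormedSpace ℝ V] [FiniteDimensional ℝ V]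
  {D : (V × (V →L[ℝ] ℝ)) →L[ℝ] (V × (V →L[ℝ] ℝ))}

theorem isInvertible_of_stdSymp_map (hD : ∀ X Y, stdSymp (D X) (D Y) = stdSymp X Y) :
    D.IsInvertible := by
  have hinj : Function.Injective D.toLinearMap := by
    refine (injective_iff_map_eq_zero _).mpr fun X hX => stdSymp_nondegenerate fun Y => ?_
    have hX' : D X = 0 := hX
    rw [← hD, hX', map_zero]
  refine ⟨(LinearEquiv.ofInjectiveEndo D.toLinearMap hinj).toContinuousLinearEquiv, ?_⟩
  ext X <;> rfl

theorem stdSymp_inverse (hD : ∀ X Y, stdSymp (D X) (D Y) = stdSymp X Y) (X Y : V × (V →L[ℝ] ℝ)) :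
    stdSymp (D.inverse X) (D.inverse Y) = stdSymp X Y := by
  obtain ⟨e, rfl⟩ := isInvertible_of_stdSymp_map hD
  rw [← hD, ContinuousLinearMap.inverse_equiv]
  simp only [ContinuousLinearEquiv.coe_coe, ContinuousLinearEquiv.apply_symm_apply]

end SymplecticMaps

section LegendreCurve

variable {n m : ℕ} {M : Type*} [TopologicalSpace M] [ChartedSpace (EuclideanSpace ℝ (Fin n)) M]
  [IsManifold (𝓡 n) ∞ M]
  {f₀ : ∀ x : M, TangentSpace (𝓡 n) x} {f : Fin m → ∀ x : M, TangentSpace (𝓡 n) x}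
  {Φ : ℝ → CotangentBundle n M → CotangentBundle n M} {lam : ℝ → CotangentBundle n M}
  {c : CotangentBundle n M} {t T : ℝ}

theorem localRep_hC (f₀ : ∀ x : M, TangentSpace (𝓡 n) x) (f : Fin m → ∀ x : M, TangentSpace (𝓡 n) x)
    (c : CotangentBundle n M) :
    localRep c (hC f) = halfSumSq fun i => localRep c (linHams f₀ f (some i)) := by
  ext y
  simp [localRep, hC, halfSumSq, hI, linHams, EuclideanSpace.norm_sq_eq]

/-- The differential of the flow, with the canonical coordinates at `c` in the target. -/
def flowFrame (Φ : ℝ → CotangentBundle n M → CotangentBundle n M) (lam : ℝ → CotangentBundle n M)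
    (c : CotangentBundle n M) (t : ℝ) : PhaseModel n →L[ℝ] PhaseModel n :=
  chartDiff c (lam t) ∘L flowDiff Φ (lam 0) t

theorem IsFlowRegular.stdSymp_flowFrame (h : IsFlowRegular Φ lam t)
    (hs : lam t ∈ (extChartAt (cotModel n) c).source) (X Y : PhaseModel n) :
    stdSymp (flowFrame Φ lam c t X) (flowFrame Φ lam c t Y) = stdSymp X Y :=
  (stdSymp_chartDiff hs _ _).trans (h.symplectic X Y)

/-- The chart differential at `lam t` cancels between the frame and the fields. Thus `Z_t` near a
given time is expressed by maps of one fixed vector space, which can be differentiated in `t`. -/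
theorem IsFlowRegular.zMap_eq (hf₀ : IsSmoothVF f₀) (hf : ∀ i, IsSmoothVF (f i))
    (h : IsFlowRegular Φ lam t) (hs : lam t ∈ (extChartAt (cotModel n) c).source) (v : Control m) :
    zMap f Φ (lam 0) t v = (flowFrame Φ lam c t).inverse
      (∑ i, v i • localFields f₀ f c (some i) (extChartAt (cotModel n) c (lam t))) := by
  have h1 : zMap f Φ (lam 0) t v = (flowDiff Φ (lam 0) t).inverse
      (∑ i, v i • hamVec (linHam (f i)) (Φ t (lam 0))) := rfl
  have h2 : ∀ i, localFields f₀ f c (some i) (extChartAt (cotModel n) c (lam t))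
      = chartDiff c (lam t) (hamVec (linHam (f i)) (lam t)) := fun i =>
    (chartDiff_hamVec hs ((contDiffAt_localRep_linHams hf₀ hf
      ((extChartAt (cotModel n) c).map_source hs) (some i)).differentiableAt (by simp))).symm
  have h3 : ∑ i, v i • localFields f₀ f c (some i) (extChartAt (cotModel n) c (lam t))
      = chartDiff c (lam t) (∑ i, v i • hamVec (linHam (f i)) (lam t)) := by
    simp only [h2, map_sum, map_smul]
  obtain ⟨e, he⟩ := chartDiff_isInvertible hs
  rw [h1, h3, h.eq, flowFrame,
    ContinuousLinearMap.IsInvertible.inverse_comp_of_left (chartDiff_isInvertible hs), ← he,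
    ContinuousLinearMap.inverse_equiv, ContinuousLinearMap.comp_apply]
  simp only [ContinuousLinearEquiv.coe_coe, ContinuousLinearEquiv.symm_apply_apply]
  rfl

/-- For `v = h_I` the combination `Σ hᵢ h⃗ᵢ` is the Hamiltonian field of `h_c`, so `Z_I` is the
pullback of a single autonomous field. -/
theorem IsFlowRegular.zI_eq (hf₀ : IsSmoothVF f₀) (hf : ∀ i, IsSmoothVF (f i))
    (h : IsFlowRegular Φ lam t) (hs : lam t ∈ (extChartAt (cotModel n) c).source) :
    zI f Φ lam t = (flowFrame Φ lam c t).inverse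
      (flatHamVF (localRep c (hC f)) (extChartAt (cotModel n) c (lam t))) := by
  rw [zI, h.zMap_eq hf₀ hf hs, localRep_hC f₀, flatHamVF_halfSumSq fun i =>
    (contDiffAt_localRep_linHams hf₀ hf ((extChartAt (cotModel n) c).map_source hs)
      (some i)).differentiableAt (by simp)]
  simp only [localRep_extChartAt hs]
  rfl

theorem contDiffAt_localRep_hC (hf : ∀ i, IsSmoothVF (f i)) {y : PhaseModel n}
    (hy : y ∈ (extChartAt (cotModel n) c).target) : ContDiffAt ℝ ∞ (localRep c (hC f)) y := by
  -- The drift is a dummy argument here: only the controlled functions occur in `h_c`.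
  rw [localRep_hC fun _ => 0]
  exact contDiffAt_halfSumSq fun i => (contDiffOn_localRep_linHam (hf i) c).contDiffAt
    ((isOpen_cot_target c).mem_nhds hy)

/-- `h_{c0c}` in canonical coordinates. -/
theorem hC0C_eq_flatPoisson (hf₀ : IsSmoothVF f₀) (hf : ∀ i, IsSmoothVF (f i))
    {ℓ : CotangentBundle n M} (hs : ℓ ∈ (extChartAt (cotModel n) c).source) :
    hC0C f₀ f ℓ = flatPoisson (localRep c (hC f))
      (flatPoisson (localRep c (linHam f₀)) (localRep c (hC f)))
      (extChartAt (cotModel n) c ℓ) := by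
  set e := extChartAt (cotModel n) c
  have h0 : ∀ y ∈ e.target, ContDiffAt ℝ ∞ (localRep c (linHam f₀)) y := fun y hy =>
    (contDiffOn_localRep_linHam hf₀ c).contDiffAt ((isOpen_cot_target c).mem_nhds hy)
  have hc : ∀ y ∈ e.target, ContDiffAt ℝ ∞ (localRep c (hC f)) y := fun y hy =>
    contDiffAt_localRep_hC hf hy
  have hy := e.map_source hs
  -- The inner bracket is differentiated once more, so it must be identified on a neighbourhood and
  -- not only at the point.
  have heq : localRep c (poisson (linHam f₀) (hC f))
      =ᶠ[𝓝 (e ℓ)] flatPoisson (localRep c (linHam f₀)) (localRep c (hC f)) := by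
    filter_upwards [(isOpen_cot_target c).mem_nhds hy] with y hy
    have h1 := poisson_eq_flatPoisson (c := c) (ℓ := e.symm y) (a := linHam f₀) (b := hC f)
      (e.map_target hy)
    rw [e.right_inv hy] at h1
    exact h1 ((h0 y hy).differentiableAt (by simp)) ((hc y hy).differentiableAt (by simp))
  have hd := (hasFDerivAt_flatPoisson (h0 _ hy) (hc _ hy)).congr_of_eventuallyEq heq
  rw [hC0C, poisson_eq_flatPoisson hs ((hc _ hy).differentiableAt (by simp)) hd.differentiableAt,
    flatPoisson, flatPoisson, heq.fderiv_eq]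

end LegendreCurve

/-! ### The time derivative of `Z_I` -/

section LegendreDerivative

variable {n m : ℕ} {M : Type*} [TopologicalSpace M] [ChartedSpace (EuclideanSpace ℝ (Fin n)) M]
  [IsManifold (𝓡 n) ∞ M]
  {f₀ : ∀ x : M, TangentSpace (𝓡 n) x} {f : Fin m → ∀ x : M, TangentSpace (𝓡 n) x}
  {Φ : ℝ → CotangentBundle n M → CotangentBundle n M} {lam : ℝ → CotangentBundle n M}
  {u : ℝ → Control m} {t T : ℝ}

theorem IsResolvent.hasDerivWithinAt_combDiff {E : Type*} [NormedAddCommGroup E] [NormedSpace ℝ E]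
    [CompleteSpace E] {ι : Type*} [Fintype ι] {X : ι → E → E} {Ω : Set E} (hΩ : IsOpen Ω)
    (hX : ∀ j, ContDiffOn ℝ ∞ (X j) Ω) {v : ℝ → ι → ℝ} {a b t : ℝ} {y : ℝ → E} {R : ℝ → E →L[ℝ] E}
    (hv : ∀ j, IntervalIntegrable (fun σ => v σ j) volume a b)
    (hv1 : ∀ σ ∈ Icc a b, ∀ j, |v σ j| ≤ 1)
    (hy : ContinuousOn y (Icc a b)) (hm : MapsTo y (Icc a b) Ω) (ht : t ∈ Icc a b)
    (hV : ∀ j, HasDerivWithinAt (fun τ => ∫ σ in a..τ, v σ j) (v t j) (Icc a b) t)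
    (hR : IsResolvent (fun σ => combDiff X (v σ) (y σ)) a b R) :
    HasDerivWithinAt R (combDiff X (v t) (y t) * R t) (Icc a b) t := by
  have h := hasDerivWithinAt_primitive_comb (g := fun j σ => fderiv ℝ (X j) (y σ) * R σ) hv hv1
    (fun j => (((hX j).continuousOn_fderiv_of_isOpen hΩ (by norm_cast)).comp hy hm).mul
      hR.continuousOn) ht hV
  have h1 := h.const_add (1 : E →L[ℝ] E)
  have h2 : ∀ σ, combDiff X (v σ) (y σ) * R σ = ∑ j, v σ j • (fderiv ℝ (X j) (y σ) * R σ) :=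
    fun σ => by simp [combDiff, Finset.sum_mul]
  rw [h2]
  refine h1.congr_of_mem (fun τ hτ => ?_) ht
  rw [hR.eq_integral τ hτ]
  simp only [h2]

theorem IsIntegralSolution.hasDerivWithinAt_combField {E : Type*} [NormedAddCommGroup E]
    [NormedSpace ℝ E] [CompleteSpace E] {ι : Type*} [Fintype ι] {X : ι → E → E} {Ω : Set E}
    (hX : ∀ j, ContDiffOn ℝ ∞ (X j) Ω) {v : ℝ → ι → ℝ} {a b t : ℝ} {y : ℝ → E}
    (hv : ∀ j, IntervalIntegrable (fun σ => v σ j) volume a b)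
    (hv1 : ∀ σ ∈ Icc a b, ∀ j, |v σ j| ≤ 1) (hm : MapsTo y (Icc a b) Ω) (ht : t ∈ Icc a b)
    (hV : ∀ j, HasDerivWithinAt (fun τ => ∫ σ in a..τ, v σ j) (v t j) (Icc a b) t)
    (hy : IsIntegralSolution (fun σ => combField X (v σ)) a b y) :
    HasDerivWithinAt y (combField X (v t) (y t)) (Icc a b) t := by
  have h := hasDerivWithinAt_primitive_comb (g := fun j σ => X j (y σ)) hv hv1
    (fun j => (hX j).continuousOn.comp hy.continuousOn hm) ht hV
  exact (h.const_add (y a)).congr_of_mem (fun τ hτ => hy.eq_integral τ hτ) ht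

theorem hasDerivWithinAt_primitive_coeff {s : Set ℝ} {a : ℝ}
    (h : ∀ i, HasDerivWithinAt (fun τ => ∫ σ in a..τ, u σ i) (u t i) s t)
    (j : Option (Fin m)) :
    HasDerivWithinAt (fun τ => ∫ σ in a..τ, coeff (u σ) j) (coeff (u t) j) s t := by
  cases j with
  | none =>
    simp only [coeff, Option.elim_none, intervalIntegral.integral_const, smul_eq_mul, mul_one]
    exact (hasDerivWithinAt_id t s).sub_const a
  | some i => exact h i

/-- The derivative of `Z_I`, in canonical coordinates at `lam t`. -/
theorem hasDerivWithinAt_zI [T2Space M] (hf₀ : IsSmoothVF f₀) (hf : ∀ i, IsSmoothVF (f i))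
    (hu : ∀ t ∈ Icc 0 T, ‖u t‖ ≤ 1)
    (hui : ∀ j, IntervalIntegrable (fun σ => coeff (u σ) j) volume 0 T)
    (hlam : IsSolution (fun t => hamVF (pmpHam f₀ f (u t))) T lam)
    (hΦ : IsFlowNear f₀ f T u (lam 0) Φ) (ht : t ∈ Icc 0 T)
    (hV : ∀ i, HasDerivWithinAt (fun τ => ∫ σ in 0..τ, u σ i) (u t i) (Icc 0 T) t)
    {y : PhaseModel n} (hy : y = extChartAt (cotModel n) (lam t) (lam t)) :
    HasDerivWithinAt (zI f Φ lam) ((flowFrame Φ lam (lam t) t).inverse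
      (fderiv ℝ (flatHamVF (localRep (lam t) (hC f))) y
          (combField (localFields f₀ f (lam t)) (coeff (u t)) y)
        - combDiff (localFields f₀ f (lam t)) (coeff (u t)) y
          (flatHamVF (localRep (lam t) (hC f)) y))) (Icc 0 T) t := by
  have hT : 0 ≤ T := ht.1.trans ht.2
  obtain ⟨ρ, C, η, hη, hbox⟩ := exists_isTimeBox hf₀ hf hlam.continuousOn ht
  set c := lam t with hc
  set e := extChartAt (cotModel n) c with he
  obtain ⟨a, ha⟩ : ∃ a, a = max 0 (t - η) := ⟨_, rfl⟩
  obtain ⟨b, hb⟩ : ∃ b, b = min T (t + η) := ⟨_, rfl⟩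
  have ha0 : 0 ≤ a := ha ▸ le_max_left _ _
  have hbT : b ≤ T := hb ▸ min_le_left _ _
  have hta : a ≤ t := ha ▸ max_le ht.1 (by linarith)
  have htb : t ≤ b := hb ▸ le_min ht.2 (by linarith)
  have htm : t ∈ Icc a b := ⟨hta, htb⟩
  have hab := hta.trans htb
  have hsub : Icc a b ⊆ Icc 0 T := Icc_subset_Icc ha0 hbT
  -- The window is clipped to `[0, T]`; at an end point it is still a relative neighbourhood, which
  -- yields the one-sided derivative.
  have hnhds : Icc a b ∈ 𝓝[Icc 0 T] t := by
    have h1 : Icc (t - η) (t + η) ∈ 𝓝 t := Icc_mem_nhds (by linarith) (by linarith)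
    rw [ha, hb, ← Icc_inter_Icc]
    exact inter_mem self_mem_nhdsWithin (mem_nhdsWithin_of_mem_nhds h1)
  have hbox := hbox a b ha0 hbT (ha ▸ le_max_right _ _) (hb ▸ min_le_right _ _)
  have hreg := isFlowRegular hf₀ hf hT hu hui hlam hΦ
  obtain ⟨R, hR, hRτ⟩ := (hreg a ⟨ha0, hab.trans hbT⟩).propagate hf₀ hf hu hui hlam hΦ hbox ha0 hab
    hbT
  have hui' : ∀ j, IntervalIntegrable (fun σ => coeff (u σ) j) volume a b := fun j =>
    (hui j).mono_set (by rwa [uIcc_of_le hab, uIcc_of_le hT])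
  have hu1 : ∀ σ ∈ Icc a b, ∀ j, |coeff (u σ) j| ≤ 1 := fun σ hσ =>
    abs_coeff_le_one (hu σ (hsub hσ))
  have hVab : ∀ j, HasDerivWithinAt (fun τ => ∫ σ in a..τ, coeff (u σ) j) (coeff (u t) j)
      (Icc a b) t := by
    intro j
    refine (((hasDerivWithinAt_primitive_coeff hV j).mono hsub).sub_const
      (∫ σ in 0..a, coeff (u σ) j)).congr_of_mem (fun τ hτ => ?_) htm
    rw [intervalIntegral.integral_interval_sub_left
      (intervalIntegrable_of_mem_Icc (hui j) ⟨le_rfl, hT⟩ (hsub hτ))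
      (intervalIntegrable_of_mem_Icc (hui j) ⟨le_rfl, hT⟩ ⟨ha0, hab.trans hbT⟩)]
  have sl := hlam.isIntegralSolution hf₀ hf hu hui hbox.box ha0 hab hbT hbox.mem_source
    hbox.mem_closedBall
  have hmaps : MapsTo (fun σ => e (lam σ)) (Icc a b) e.target := fun σ hσ =>
    e.map_source (hbox.mem_source σ hσ)
  have hX := contDiffOn_localFields hf₀ hf c
  have hRd := hR.hasDerivWithinAt_combDiff (isOpen_cot_target c) hX hui' hu1 sl.continuousOn hmaps
    htm hVab
  have hyd := sl.hasDerivWithinAt_combField hX hui' hu1 hmaps htm hVab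
  have hframe : ∀ τ ∈ Icc a b, flowFrame Φ lam c τ = R τ ∘L flowFrame Φ lam c a := fun τ hτ =>
    (hRτ τ hτ).2
  have hPd : HasDerivWithinAt (flowFrame Φ lam c)
      (combDiff (localFields f₀ f c) (coeff (u t)) y ∘L flowFrame Φ lam c t) (Icc a b) t := by
    have h1 := hRd.clm_comp (hasDerivWithinAt_const t (Icc a b) (flowFrame Φ lam c a))
    refine (h1.congr_of_mem hframe htm).congr_deriv ?_
    rw [hframe t htm, hy]
    simp only [ContinuousLinearMap.comp_zero, add_zero]
    rfl
  have hdc : HasDerivWithinAt (fun τ => flatHamVF (localRep c (hC f)) (e (lam τ)))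
      (fderiv ℝ (flatHamVF (localRep c (hC f))) y
        (combField (localFields f₀ f c) (coeff (u t)) y)) (Icc a b) t := by
    have h1 := (differentiableAt_flatHamVF (contDiffAt_localRep_hC hf (hmaps htm))).hasFDerivAt
    rw [hy]
    exact h1.comp_hasDerivWithinAt t hyd
  have hinv : (flowFrame Φ lam c t).IsInvertible :=
    isInvertible_of_stdSymp_map ((hreg t ht).stdSymp_flowFrame (hbox.mem_source t htm))
  -- With `Ṗ = A P` the term `Ṗ P⁻¹ x` of the quotient rule is `A x`, so the result is `P⁻¹` of a
  -- Lie bracket.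
  have hz := hasDerivWithinAt_inverse_apply hPd hinv hdc
  refine ((hz.congr_of_mem (fun τ hτ => (hRτ τ hτ).1.zI_eq hf₀ hf (hbox.mem_source τ hτ))
    htm).mono_of_mem_nhdsWithin hnhds).congr_deriv ?_
  obtain ⟨E, hE⟩ := hinv
  rw [ContinuousLinearMap.comp_apply, ← hE, ContinuousLinearMap.inverse_equiv]
  simp only [ContinuousLinearEquiv.coe_coe, ContinuousLinearEquiv.apply_symm_apply, hy]
  rfl

end LegendreDerivative

/-! ### The Legendre form and its completed square -/

section LegendreForm

variable {n m : ℕ} {M : Type*} [TopologicalSpace M] [ChartedSpace (EuclideanSpace ℝ (Fin n)) M]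
  [IsManifold (𝓡 n) ∞ M]
  {f₀ : ∀ x : M, TangentSpace (𝓡 n) x} {f : Fin m → ∀ x : M, TangentSpace (𝓡 n) x}
  {Φ : ℝ → CotangentBundle n M → CotangentBundle n M} {lam : ℝ → CotangentBundle n M}
  {u : ℝ → Control m} {t T : ℝ}

/-- The off-diagonal entries of the matrix of the Legendre form. -/
def legendreVec (f : Fin m → ∀ x : M, TangentSpace (𝓡 n) x)
    (Φ : ℝ → CotangentBundle n M → CotangentBundle n M) (lam : ℝ → CotangentBundle n M) (t : ℝ) :
    Control m :=
  WithLp.toLp 2 fun i =>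
    symplecticForm (lam 0) (zMap f Φ (lam 0) t (EuclideanSpace.single i 1)) (zI f Φ lam t)

theorem legendreForm_eq (w : Control m) (φ : ℝ) :
    legendreForm f T u lam Φ t w φ = 1 / ‖u t‖ * ‖w‖ ^ 2 + 2 * φ * inner ℝ (legendreVec f Φ lam t) w
      + φ ^ 2 * symplecticForm (lam 0) (zI f Φ lam t) (zIDot f T Φ lam t) := by
  rw [EuclideanSpace.norm_sq_eq, PiLp.inner_apply, Finset.mul_sum, Finset.mul_sum,
    ← Finset.sum_add_distrib]
  simp only [legendreForm, legendreMatrix, dotProduct, Matrix.mulVec, Fintype.sum_sum_type,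
    Matrix.fromBlocks_apply₁₁, Matrix.fromBlocks_apply₁₂, Matrix.fromBlocks_apply₂₁,
    Matrix.fromBlocks_apply₂₂, Sum.elim_inl, Sum.elim_inr, Matrix.of_apply, Matrix.smul_apply,
    Matrix.one_apply, Finset.univ_unique, Finset.sum_singleton, legendreVec, smul_eq_mul]
  simp only [mul_ite, mul_one, mul_zero, ite_mul, zero_mul, Finset.sum_ite_eq, Finset.mem_univ,
    if_true, mul_add, Finset.mul_sum]
  rw [← add_assoc, ← Finset.sum_add_distrib]
  congr 1
  · refine Finset.sum_congr rfl fun i _ => ?_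
    simp
    ring
  · ring

theorem legendreMatrix_isHermitian : (legendreMatrix f T u lam Φ t).IsHermitian := by
  rw [legendreMatrix, Matrix.isHermitian_fromBlocks_iff]
  refine ⟨?_, ?_, ?_, ?_⟩ <;> ext i j <;> simp [Matrix.one_apply, eq_comm]

theorem forall_legendreMatrix_iff {p : ℝ → Prop} {q : (Fin m ⊕ Unit → ℝ) → Prop} :
    (∀ x : Fin m ⊕ Unit → ℝ, q x → p (star x ⬝ᵥ (legendreMatrix f T u lam Φ t *ᵥ x))) ↔
      ∀ (w : Control m) (φ : ℝ), q (Sum.elim (fun i => w i) fun _ => φ) →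
        p (legendreForm f T u lam Φ t w φ) := by
  constructor
  · intro h w φ hq
    exact h _ hq
  · intro h x hq
    have hx : x = Sum.elim (fun i => (WithLp.toLp 2 (x ∘ Sum.inl) : Control m) i)
        fun _ => x (Sum.inr ()) := by
      ext i
      rcases i with i | i <;> rfl
    have := h (WithLp.toLp 2 (x ∘ Sum.inl)) (x (Sum.inr ())) (hx ▸ hq)
    simp only [legendreForm] at this
    rwa [← hx] at this

/-- The shift of `w` by `r φ a` absorbs the cross term, and its own square accounts exactly for `φ²
r ‖a‖²`. -/
theorem completed_square {E : Type*} [NormedAddCommGroup E] [InnerProductSpace ℝ E]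
    {Q : E → ℝ → ℝ} {a : E} {r h : ℝ} (hr : 0 < r)
    (hQ : ∀ w φ, Q w φ = 1 / r * ‖w‖ ^ 2 + 2 * φ * inner ℝ a w + φ ^ 2 * (h + r * ‖a‖ ^ 2))
    (w : E) (φ : ℝ) : Q w φ = 1 / r * ‖w + (r * φ) • a‖ ^ 2 + φ ^ 2 * h := by
  rw [hQ, norm_add_sq_real, inner_smul_right, norm_smul, real_inner_comm, mul_pow,
    Real.norm_eq_abs, sq_abs]
  field_simp
  ring

/-- Completing the square: positivity of the form `|w|² / r + 2 φ ⟨a, w⟩ + φ² (h + r |a|²)`. -/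
theorem completed_square_nonneg_iff {E : Type*} [NormedAddCommGroup E] [InnerProductSpace ℝ E]
    {Q : E → ℝ → ℝ} {a : E} {r h : ℝ} (hr : 0 < r)
    (hQ : ∀ w φ, Q w φ = 1 / r * ‖w‖ ^ 2 + 2 * φ * inner ℝ a w + φ ^ 2 * (h + r * ‖a‖ ^ 2))
    {p : E → Prop} (hp : p (-r • a)) : (∀ w φ, p w → 0 ≤ Q w φ) ↔ 0 ≤ h := by
  have hsq := completed_square hr hQ
  constructor
  · intro H
    -- At `w = -r a`, `φ = 1` the square vanishes and the value is `h`. The constraint `p` matters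
    -- only through this vector.
    have := H _ 1 hp
    rw [hsq] at this
    simpa using this
  · intro H w φ _
    rw [hsq]
    positivity

theorem completed_square_pos_iff {E : Type*} [NormedAddCommGroup E] [InnerProductSpace ℝ E]
    {Q : E → ℝ → ℝ} {a : E} {r h : ℝ} (hr : 0 < r)
    (hQ : ∀ w φ, Q w φ = 1 / r * ‖w‖ ^ 2 + 2 * φ * inner ℝ a w + φ ^ 2 * (h + r * ‖a‖ ^ 2))
    {p : E → Prop} (hp : p (-r • a)) :
    (∀ w φ, p w → (w ≠ 0 ∨ φ ≠ 0) → 0 < Q w φ) ↔ 0 < h := by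
  have hsq := completed_square hr hQ
  constructor
  · intro H
    have := H _ 1 hp (Or.inr one_ne_zero)
    rw [hsq] at this
    simpa using this
  · intro H w φ _ hne
    rw [hsq]
    -- For `φ = 0` the positivity comes from `‖w‖² / r` with `w ≠ 0`; otherwise from `φ² h`.
    by_cases hφ : φ = 0
    · have hw : w ≠ 0 := by tauto
      simp only [hφ, mul_zero, zero_smul, add_zero]
      positivity
    · positivity

/-- The equivalences, from the two identities satisfied by the entries of the matrix. -/
theorem legendre_equivalences {k : Control m} {h : ℝ} (hr : 0 < ‖u t‖)
    (horth : inner ℝ k (legendreVec f Φ lam t) = 0)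
    (hval : symplecticForm (lam 0) (zI f Φ lam t) (zIDot f T Φ lam t)
      = h + ‖u t‖ * ‖legendreVec f Φ lam t‖ ^ 2) :
    ((∀ (w : Control m) (φ : ℝ), inner ℝ k w = 0 →
        0 ≤ legendreForm f T u lam Φ t w φ) ↔ 0 ≤ h) ∧
    ((∀ (w : Control m) (φ : ℝ), inner ℝ k w = 0 → (w ≠ 0 ∨ φ ≠ 0) →
        0 < legendreForm f T u lam Φ t w φ) ↔ 0 < h) ∧
    ((legendreMatrix f T u lam Φ t).PosSemidef ↔ 0 ≤ h) ∧
    ((legendreMatrix f T u lam Φ t).PosDef ↔ 0 < h) := by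
  have hQ : ∀ w φ, legendreForm f T u lam Φ t w φ = 1 / ‖u t‖ * ‖w‖ ^ 2
      + 2 * φ * inner ℝ (legendreVec f Φ lam t) w
      + φ ^ 2 * (h + ‖u t‖ * ‖legendreVec f Φ lam t‖ ^ 2) := fun w φ => by
    rw [legendreForm_eq, hval]
  -- The critical vector lies in `k^⊥`, so restricting the form loses nothing.
  have hp : inner ℝ k (-‖u t‖ • legendreVec f Φ lam t) = 0 := by
    rw [inner_smul_right, horth, mul_zero]
  refine ⟨completed_square_nonneg_iff hr hQ hp, completed_square_pos_iff hr hQ hp, ?_, ?_⟩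
  · rw [Matrix.posSemidef_iff_dotProduct_mulVec, and_iff_right legendreMatrix_isHermitian]
    have h1 := forall_legendreMatrix_iff (f := f) (T := T) (u := u) (lam := lam) (Φ := Φ) (t := t)
      (p := fun z => 0 ≤ z) (q := fun _ => True)
    have h2 := completed_square_nonneg_iff hr hQ (p := fun _ => True) trivial
    simp only [true_imp_iff] at h1 h2
    exact h1.trans h2
  · rw [Matrix.posDef_iff_dotProduct_mulVec, and_iff_right legendreMatrix_isHermitian]
    have h1 := forall_legendreMatrix_iff (f := f) (T := T) (u := u) (lam := lam) (Φ := Φ) (t := t)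
      (p := fun z => 0 < z) (q := fun x => x ≠ 0)
    have h2 := completed_square_pos_iff hr hQ (p := fun _ => True) trivial
    simp only [true_imp_iff] at h2
    refine Iff.trans h1 (Iff.trans (forall₂_congr fun w φ => ?_) h2)
    have h3 : (Sum.elim (fun i => w i) fun _ => φ : Fin m ⊕ Unit → ℝ) ≠ 0 ↔ w ≠ 0 ∨ φ ≠ 0 := by
      rw [← not_and_or, not_iff_not]
      constructor
      · intro hx
        exact ⟨PiLp.ext fun i => congrFun hx (Sum.inl i), congrFun hx (Sum.inr ())⟩
      · rintro ⟨rfl, rfl⟩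
        ext i
        rcases i with i | i <;> rfl
    rw [h3]

/-- The identities satisfied by the entries of the matrix of the Legendre form. -/
theorem legendreVec_identities (hT : 0 < T) (hf₀ : IsSmoothVF f₀)
    (hf : ∀ i, IsSmoothVF (f i)) (hreg : IsFlowRegular Φ lam t) (ht : t ∈ Icc 0 T)
    (hu : u t = ‖u t‖ • hI f (lam t))
    {y : PhaseModel n} (hy : y = extChartAt (cotModel n) (lam t) (lam t))
    (hz : HasDerivWithinAt (zI f Φ lam) ((flowFrame Φ lam (lam t) t).inverse
      (fderiv ℝ (flatHamVF (localRep (lam t) (hC f))) y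
          (combField (localFields f₀ f (lam t)) (coeff (u t)) y)
        - combDiff (localFields f₀ f (lam t)) (coeff (u t)) y
          (flatHamVF (localRep (lam t) (hC f)) y))) (Icc 0 T) t) :
    inner ℝ (hI f (lam t)) (legendreVec f Φ lam t) = 0 ∧
    symplecticForm (lam 0) (zI f Φ lam t) (zIDot f T Φ lam t)
      = hC0C f₀ f (lam t) + ‖u t‖ * ‖legendreVec f Φ lam t‖ ^ 2 := by
  have hs := mem_extChartAt_source (I := cotModel n) (lam t)
  have hyt : y ∈ (extChartAt (cotModel n) (lam t)).target := by
    rw [hy]; exact (extChartAt (cotModel n) (lam t)).map_source hs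
  have hD := hreg.stdSymp_flowFrame hs
  set c := lam t with hc
  let g : Option (Fin m) → PhaseModel n → ℝ := fun j => localRep c (linHams f₀ f j)
  have hgat : ∀ j, ContDiffAt ℝ ∞ (g j) y := contDiffAt_localRep_linHams hf₀ hf hyt
  have hcat : ContDiffAt ℝ ∞ (localRep c (hC f)) y := contDiffAt_localRep_hC hf hyt
  have hvec : ∀ i, legendreVec f Φ lam t i
      = stdSymp (flatHamVF (g (some i)) y) (flatHamVF (localRep c (hC f)) y) := by
    intro i
    have h1 : legendreVec f Φ lam t i = stdSymp (zMap f Φ (lam 0) t (EuclideanSpace.single i 1))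
      (zI f Φ lam t) := rfl
    rw [h1, hreg.zMap_eq hf₀ hf hs, hreg.zI_eq hf₀ hf hs, stdSymp_inverse hD, ← hy]
    congr 2
    rw [Finset.sum_eq_single i (fun j _ hj => by simp [hj]) (fun h => (h (Finset.mem_univ i)).elim)]
    simp [localFields, g]
  have hIi : ∀ i, hI f c i = g (some i) y := fun i => by
    rw [hy]
    exact (localRep_extChartAt hs (linHams f₀ f (some i))).symm
  obtain ⟨h0, hsq⟩ := sum_mul_flatPoisson_halfSumSq (isOpen_cot_target c) hyt
    fun i => contDiffOn_localRep_linHams hf₀ hf c (some i)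
  rw [← localRep_hC] at h0 hsq
  constructor
  -- The inner product is `Σ hᵢ {hᵢ, h_c} = {h_c, h_c}`.
  · rw [PiLp.inner_apply, ← h0]
    refine Finset.sum_congr rfl fun i _ => ?_
    rw [hvec, hIi]
    simp [g, mul_comm]
  · have hdot : zIDot f T Φ lam t = _ :=
      hz.derivWithin (uniqueDiffOn_Icc hT t ht)
    rw [symplecticForm_eq_stdSymp, hdot, hreg.zI_eq hf₀ hf hs, stdSymp_inverse hD, ← hy]
    have hsum : fderiv ℝ (flatHamVF (localRep c (hC f))) y
          (combField (localFields f₀ f c) (coeff (u t)) y)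
        - combDiff (localFields f₀ f c) (coeff (u t)) y (flatHamVF (localRep c (hC f)) y)
        = ∑ j, coeff (u t) j • (fderiv ℝ (flatHamVF (localRep c (hC f))) y (flatHamVF (g j) y)
          - fderiv ℝ (flatHamVF (g j)) y (flatHamVF (localRep c (hC f)) y)) := by
      rw [combField, map_sum, combDiff_apply, ← Finset.sum_sub_distrib]
      refine Finset.sum_congr rfl fun j _ => ?_
      rw [map_smul, smul_sub]
      rfl
    rw [hsum, map_sum]
    have hterm : ∀ j, stdSymp (flatHamVF (localRep c (hC f)) y) (coeff (u t) j •
        (fderiv ℝ (flatHamVF (localRep c (hC f))) y (flatHamVF (g j) y)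
          - fderiv ℝ (flatHamVF (g j)) y (flatHamVF (localRep c (hC f)) y)))
        = coeff (u t) j * flatPoisson (localRep c (hC f)) (flatPoisson (g j) (localRep c (hC f))) y :=
      fun j => by rw [map_smul, flatPoisson_flatPoisson (hgat j) hcat, smul_eq_mul]
    simp only [hterm]
    rw [Fintype.sum_option, hC0C_eq_flatPoisson hf₀ hf hs, ← hy]
    have hnorm : ‖legendreVec f Φ lam t‖ ^ 2 = ∑ i, stdSymp (flatHamVF (g (some i)) y)
        (flatHamVF (localRep c (hC f)) y) ^ 2 := by
      rw [EuclideanSpace.norm_sq_eq]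
      refine Finset.sum_congr rfl fun i _ => ?_
      rw [hvec, Real.norm_eq_abs, sq_abs]
    -- The drift contributes `h_{c0c}`. Since `uᵢ = ‖u‖ hᵢ`, the controlled terms add up to `‖u‖ Σ
    -- hᵢ {h_c, {hᵢ, h_c}}`, which is `‖u‖ |a|²`.
    rw [hnorm, ← hsq, Finset.mul_sum]
    congr 1
    · simp [coeff, g, linHams]
    · refine Finset.sum_congr rfl fun i _ => ?_
      have h1 : coeff (u t) (some i) = ‖u t‖ * g (some i) y := by
        rw [← hIi]
        exact congrArg (fun v : Control m => v i) hu
      rw [h1, mul_assoc]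

end LegendreForm

/-! ### The control along a singular extremal -/

section SingularExtremals

variable {n m : ℕ} {M : Type*} [TopologicalSpace M] [ChartedSpace (EuclideanSpace ℝ (Fin n)) M]
  [IsManifold (𝓡 n) ∞ M]
  {f₀ : ∀ x : M, TangentSpace (𝓡 n) x} {f : Fin m → ∀ x : M, TangentSpace (𝓡 n) x}
  {lam : ℝ → CotangentBundle n M} {u : ℝ → Control m} {t T : ℝ}

theorem continuous_hI (hf : ∀ i, IsSmoothVF (f i)) : Continuous (hI (n := n) f) := by
  refine (PiLp.continuous_toLp 2 _).comp (continuous_pi fun i => ?_)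
  refine continuous_iff_continuousAt.mpr fun ℓ => ?_
  have hs := mem_extChartAt_source (I := cotModel n) ℓ
  exact (hasMFDerivAt_of_localRep hs (((contDiffOn_localRep_linHam (hf i) ℓ).contDiffAt
    ((isOpen_cot_target ℓ).mem_nhds ((extChartAt (cotModel n) ℓ).map_source hs))).differentiableAt
      (by simp))).continuousAt

theorem IsSingularExtremal.intervalIntegrable_control (h : IsSingularExtremal f₀ f T u lam)
    (hT : 0 ≤ T) (i : Fin m) : IntervalIntegrable (fun σ => u σ i) volume 0 T := by
  rw [intervalIntegrable_iff_integrableOn_Icc_of_le hT]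
  refine Integrable.of_bound (C := 1)
    ((EuclideanSpace.proj i : Control m →L[ℝ] ℝ).continuous.measurable.comp_aemeasurable
      h.aemeasurable).aestronglyMeasurable ?_
  filter_upwards [ae_restrict_mem measurableSet_Icc] with σ hσ
  exact (PiLp.norm_apply_le (u σ) i).trans (h.norm_le_one σ hσ)

theorem IsSingularExtremal.intervalIntegrable_coeff (h : IsSingularExtremal f₀ f T u lam)
    (hT : 0 ≤ T) (j : Option (Fin m)) :
    IntervalIntegrable (fun σ => coeff (u σ) j) volume 0 T := by
  cases j with
  | none => exact intervalIntegrable_const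
  | some i => exact h.intervalIntegrable_control hT i

/-- The maximum principle: the control is a nonnegative multiple of `h_I`. -/
theorem IsSingularExtremal.ae_eq_smul_hI (h : IsSingularExtremal f₀ f T u lam) :
    ∀ᵐ t, t ∈ Icc 0 T → u t = ‖u t‖ • hI f (lam t) := by
  filter_upwards [h.maximum] with t ht htm
  -- Comparison with `v = 0` gives `‖u‖ ≤ ⟨u, h_I⟩`. As `‖h_I‖ = 1`, this is the equality case of
  -- Cauchy–Schwarz.
  have h0 := ht htm 0 (by simp)
  have hk := h.singular t htm
  have hin : inner ℝ (u t) (hI f (lam t)) = ∑ i, u t i * hI f (lam t) i := by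
    rw [PiLp.inner_apply]
    exact Finset.sum_congr rfl fun i _ => by simp [mul_comm]
  have h1 : ‖u t‖ ≤ inner ℝ (u t) (hI f (lam t)) := by
    rw [hin]
    simp only [pmpHam, PiLp.zero_apply, zero_mul, Finset.sum_const_zero, norm_zero] at h0
    linarith
  have h2 : inner ℝ (u t) (hI f (lam t)) = ‖u t‖ * ‖hI f (lam t)‖ :=
    le_antisymm (real_inner_le_norm _ _) (by rwa [hk, mul_one])
  have h3 := inner_eq_norm_mul_iff_real.mp h2
  rwa [hk, one_smul] at h3

/-- The relation holds almost everywhere, hence on a dense set, and passes to the limit at points of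
continuity of `u`. -/
theorem IsSingularExtremal.eq_smul_hI_of_continuousWithinAt (h : IsSingularExtremal f₀ f T u lam)
    (hf : ∀ i, IsSmoothVF (f i)) (hT : 0 < T) (ht : t ∈ Icc 0 T)
    (hc : ContinuousWithinAt u (Icc 0 T) t) : u t = ‖u t‖ • hI f (lam t) := by
  let D : Set ℝ := {t | t ∈ Icc 0 T → u t = ‖u t‖ • hI f (lam t)}
  have hD : Dense D := Measure.dense_of_ae h.ae_eq_smul_hI
  -- Outside `[0, T]` membership in `D` is vacuous, so the approximating times must be taken inside;
  -- the open interval lets density apply.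
  have hcl : t ∈ closure (Ioo 0 T ∩ D) := by
    have h1 := closure_mono (hD.open_subset_closure_inter (isOpen_Ioo (a := (0 : ℝ)) (b := T)))
    rw [closure_closure, closure_Ioo hT.ne] at h1
    exact h1 ht
  have hlam : ContinuousWithinAt (fun t => hI f (lam t)) (Icc 0 T) t :=
    (continuous_hI hf).continuousAt.comp_continuousWithinAt (h.isSolution.continuousOn t ht)
  have hφ := (hc.sub (hc.norm.smul hlam)).mono
    (inter_subset_left.trans Ioo_subset_Icc_self : Ioo 0 T ∩ D ⊆ Icc 0 T)
  have h0 := hφ.mem_closure hcl (t := {0}) fun τ hτ =>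
    sub_eq_zero.mpr (hτ.2 (Ioo_subset_Icc_self hτ.1))
  rw [closure_singleton] at h0
  exact sub_eq_zero.mp h0

theorem IsSingularExtremal.ae_hasDerivWithinAt_primitive (h : IsSingularExtremal f₀ f T u lam)
    (hT : 0 ≤ T) : ∀ᵐ t, t ∈ Icc 0 T → ∀ i,
      HasDerivWithinAt (fun τ => ∫ σ in 0..τ, u σ i) (u t i) (Icc 0 T) t := by
  filter_upwards [ae_all_iff.mpr fun i => (h.intervalIntegrable_control hT i).ae_hasDerivAt_integral]
    with t ht htm i
  rw [uIcc_of_le hT] at ht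
  exact (ht i htm 0 ⟨le_rfl, hT⟩).hasDerivWithinAt

theorem IsSingularExtremal.hasDerivWithinAt_primitive (h : IsSingularExtremal f₀ f T u lam)
    (ht : t ∈ Icc 0 T) (hc : ContinuousWithinAt u (Icc 0 T) t) (i : Fin m) :
    HasDerivWithinAt (fun τ => ∫ σ in 0..τ, u σ i) (u t i) (Icc 0 T) t := by
  have hT : 0 ≤ T := ht.1.trans ht.2
  have hi := h.intervalIntegrable_control hT i
  have : Fact (t ∈ Icc 0 T) := ⟨ht⟩
  refine intervalIntegral.integral_hasDerivWithinAt_right (t := Icc 0 T)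
    (intervalIntegrable_of_mem_Icc hi ⟨le_rfl, hT⟩ ht) ⟨Icc 0 T, self_mem_nhdsWithin, ?_⟩ ?_
  · exact ((intervalIntegrable_iff_integrableOn_Icc_of_le hT).mp hi).aestronglyMeasurable
  · exact (EuclideanSpace.proj i : Control m →L[ℝ] ℝ).continuous.continuousAt.comp_continuousWithinAt
      hc

end SingularExtremals

end

theorem mainTheorem5 {n m : ℕ} {M : Type*} [TopologicalSpace M] [T2Space M]
    [ChartedSpace (EuclideanSpace ℝ (Fin n)) M] [IsManifold (𝓡 n) ∞ M]
    (f₀ : ∀ x : M, TangentSpace (𝓡 n) x) (f : Fin m → ∀ x : M, TangentSpace (𝓡 n) x)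
    (hf₀ : IsSmoothVF f₀) (hf : ∀ i, IsSmoothVF (f i))
    (T : ℝ) (hT : 0 < T) (u : ℝ → Control m) (lam : ℝ → CotangentBundle n M)
    (hlam : IsSingularExtremal f₀ f T u lam)
    (Φ : ℝ → CotangentBundle n M → CotangentBundle n M)
    (hΦ : IsFlowNear f₀ f T u (lam 0) Φ) :
    -- the objects entering the Legendre form make sense
    (∀ t ∈ Icc 0 T, MDifferentiableAt (cotModel n) (cotModel n) (Φ t) (lam 0) ∧
      (mfderiv (cotModel n) (cotModel n) (Φ t) (lam 0)).IsInvertible) ∧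
    -- the equivalences hold at almost every time, and at each time at which `u` is continuous
    ∃ S : Set ℝ, (∀ᵐ t, t ∈ Icc 0 T → t ∈ S) ∧
      (∀ t ∈ Icc 0 T, ContinuousWithinAt u (Icc 0 T) t → t ∈ S) ∧
      ∀ t ∈ S, DifferentiableWithinAt ℝ (zI f Φ lam) (Icc 0 T) t ∧
        (0 < ‖u t‖ →
          -- on `h_I(t)^⊥ ⊕ ℝ`
          ((∀ (w : Control m) (φ : ℝ), inner ℝ (hI f (lam t)) w = 0 →
              0 ≤ legendreForm f T u lam Φ t w φ) ↔ 0 ≤ hC0C f₀ f (lam t)) ∧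
          ((∀ (w : Control m) (φ : ℝ), inner ℝ (hI f (lam t)) w = 0 → (w ≠ 0 ∨ φ ≠ 0) →
              0 < legendreForm f T u lam Φ t w φ) ↔ 0 < hC0C f₀ f (lam t)) ∧
          -- for the whole `(m+1) × (m+1)` matrix
          ((legendreMatrix f T u lam Φ t).PosSemidef ↔ 0 ≤ hC0C f₀ f (lam t)) ∧
          ((legendreMatrix f T u lam Φ t).PosDef ↔ 0 < hC0C f₀ f (lam t))) := by
  have hui := hlam.intervalIntegrable_coeff hT.le
  have hreg := isFlowRegular hf₀ hf hT.le hlam.norm_le_one hui hlam.isSolution hΦ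
  -- `S` collects the two pointwise properties of `u` that the computation uses. They hold almost
  -- everywhere by Lebesgue differentiation and the maximum principle, and at continuity points by
  -- the fundamental theorem of calculus and density.
  refine ⟨fun t ht => ⟨(hreg t ht).mdifferentiableAt,
    isInvertible_of_stdSymp_map (hreg t ht).symplectic⟩,
    {t | t ∈ Icc 0 T ∧ (∀ i, HasDerivWithinAt (fun τ => ∫ σ in 0..τ, u σ i) (u t i) (Icc 0 T) t) ∧
      u t = ‖u t‖ • hI f (lam t)}, ?_, ?_, ?_⟩
  · filter_upwards [hlam.ae_eq_smul_hI, hlam.ae_hasDerivWithinAt_primitive hT.le] with t h1 h2 ht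
    exact ⟨ht, h2 ht, h1 ht⟩
  · exact fun t ht hc => ⟨ht, hlam.hasDerivWithinAt_primitive ht hc,
      hlam.eq_smul_hI_of_continuousWithinAt hf hT ht hc⟩
  · rintro t ⟨ht, hV, hu⟩
    have hz := hasDerivWithinAt_zI hf₀ hf hlam.norm_le_one hui hlam.isSolution hΦ ht hV rfl
    obtain ⟨horth, hval⟩ := legendreVec_identities hT hf₀ hf (hreg t ht) ht hu rfl hz
    exact ⟨hz.differentiableWithinAt, fun hr => legendre_equivalences hr horth hval⟩
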